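/- Let $\lambda_W,\lambda_L,P_W,P_L,\Gamma_{cs},\Gamma_{ed},\Gamma^L,\mu,\alpha,\lambda_c>0$ and let $\ell(d)=(4\pi/\lambda_c)^2 d^{\alpha}$ be the path loss at distance $d$. Let the Wi-Fi access points (APs) $\Phi_W=\{x_i\}_{i\ge 0}$ and the LTE eNodeBs (eNBs) $\Phi_L=\{y_k\}_{k\ge 0}$ be independent homogeneous Poisson point processes on $\mathbb{R}^2$ with intensities $\lambda_W$ and $\lambda_L$, enumerated so that $x_0$ and $y_0$ (the tagged AP and the tagged eNB) are the points of $\Phi_W$ and of $\Phi_L$ closest to the origin, where the typical user is located. Independently of the locations, let there be mutually independent random variables: back-off timers $t_i^W$, $t_k^L$, uniform on $[0,1]$ (listen-before-talk and random back-off with LTE contention window $[a,b]=[0,1]$), and Rayleigh fading variables $G_{ji}^W$ (AP $x_j$ to AP $x_i$), $G_{mi}^{LW}$ (eNB $y_m$ to AP $x_i$), $G_{jk}^{WL}$ (AP $x_j$ to eNB $y_k$), $G_{mk}^L$ (eNB $y_m$ to eNB $y_k$), exponential with parameter $\mu$. The medium access indicators are $$e_i^W=\prod_{j\neq i}\Bigl(\mathbf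 1_{t_j^W\ge t_i^W}+\mathbf 1_{t_j^W<t_i^W}\mathbf 1_{G_{ji}^W/\ell(\|x_j-x_i\|)\le \Gamma_{cs}/P_W}\Bigr)\prod_{m}\Bigl(\mathbf 1_{t_m^L\ge t_i^W}+\mathbf 1_{t_m^L<t_i^W}\mathbf 1_{G_{mi}^{LW}/\ell(\|y_m-x_i\|)\le \Gamma_{ed}/P_L}\Bigr),$$ $$e_k^L=\prod_{j}\Bigl(\mathbf 1_{t_j^W\ge t_k^L}+\mathbf 1_{t_j^W<t_k^L}\mathbf 1_{G_{jk}^{WL}/\ell(\|y_k-x_j\|)\le \Gamma^L/P_W}\Bigr)\prod_{m\ne k}\Bigl(\mathbf 1_{t_m^L\ge t_k^L}+\mathbf 1_{t_m^L<t_k^L}\mathbf 1_{G_{mk}^{L}/\ell(\|y_m-y_k\|)\le \Gamma^L/P_L}\Bigr).$$ For $\bullet\in\{W,L\}$, $y\in\mathbb{R}^2$, $r\ge 0$ and $\Gamma>0$, with $B(0,r)$ the closed ball, put $$N_0^{\bullet}(y,r,\Gamma)=\lambda_{\bullet}\int_{\mathbb{R}^2\setminus B(0,r)}\exp\Bigl(-\mu\frac{\Gamma}{P_{\bullet}}\ell(\|x-y\|)\Bigr)\,dx,\qquad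 f_{\bullet}(r)=2\pi\lambda_{\bullet} r\,e^{-\lambda_{\bullet}\pi r^2},$$ and $N_2^W(r)=N_0^W((r,0),r,\Gamma_{cs})$, $N^L=N_0^L(0,0,\Gamma_{ed})$, $N_3^W(\Gamma)=N_0^W(0,0,\Gamma)$, $N_1^L(r,\Gamma)=N_0^L((r,0),r,\Gamma)$. Then the medium access probabilities of the tagged AP and of the tagged eNB are $$\mathbb{E}(e_0^W)=\int_0^\infty\frac{1-\exp(-N_2^W(r_0)-N^L)}{N_2^W(r_0)+N^L}\,f_W(r_0)\,dr_0,$$ $$\mathbb{E}(e_0^L)=\int_0^\infty\frac{1-\exp(-N_3^W(\Gamma^L)-N_1^L(r_0,\Gamma^L))}{N_3^W(\Gamma^L)+N_1^L(r_0,\Gamma^L)}\,f_L(r_0)\,dr_0,$$ where all the expectations and integrals exist. -/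

import Mathlib

open MeasureTheory ProbabilityTheory
open scoped ENNReal NNReal

namespace LBT

noncomputable section

/-- The plane `ℝ²` with its Euclidean norm and Lebesgue measure. -/
abbrev Plane := EuclideanSpace ℝ (Fin 2)

/-- The deterministic parameters of the two coexisting networks (in linear scale). -/
structure Params where
  /-- Intensity of the Wi-Fi access points. -/
  lamW : ℝ
  /-- Intensity of the LTE eNBs. -/
  lamL : ℝ
  /-- Transmit power of an access point. -/
  powW : ℝ
  /-- Transmit power of an eNB. -/
  powL : ℝ
  /-- Threshold `Γ_cs` with which an access point senses access points. -/
  gamCS : ℝ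
  /-- Threshold `Γ_ed` with which an access point senses eNBs. -/
  gamED : ℝ
  /-- Common threshold `Γ^L` with which an eNB senses access points and eNBs. -/
  gamL : ℝ
  /-- Rate of the exponential law of the fading variables. -/
  mu : ℝ
  /-- Path loss exponent. -/
  alpha : ℝ
  /-- Carrier wavelength. -/
  wavelength : ℝ
  lamW_pos : 0 < lamW
  lamL_pos : 0 < lamL
  powW_pos : 0 < powW
  powL_pos : 0 < powL
  gamCS_pos : 0 < gamCS
  gamED_pos : 0 < gamED
  gamL_pos : 0 < gamL
  mu_pos : 0 < mu
  alpha_pos : 0 < alpha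
  wavelength_pos : 0 < wavelength

namespace Params

variable (p : Params)

/-- Path loss `ℓ(d)` in linear scale (reference distance one metre); in decibels it is
`20 log₁₀ (4π/λ_c) + 10 α log₁₀ d`, see `pathLoss_dB`. -/
def pathLoss (d : ℝ) : ℝ := (4 * Real.pi / p.wavelength) ^ 2 * d ^ p.alpha

theorem pathLoss_dB {d : ℝ} (hd : 0 < d) :
    10 * Real.logb 10 (p.pathLoss d) =
      20 * Real.logb 10 (4 * Real.pi / p.wavelength) + 10 * p.alpha * Real.logb 10 d := by
  have h1 : 0 < 4 * Real.pi / p.wavelength :=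
    div_pos (mul_pos (by norm_num) Real.pi_pos) p.wavelength_pos
  rw [pathLoss, Real.logb_mul (pow_pos h1 2).ne' (Real.rpow_pos_of_pos hd _).ne',
    Real.logb_pow, Real.logb_rpow_eq_mul_logb_of_pos hd]
  push_cast
  ring

/-- `N₀^W(y, r, Γ)`: mean number of access points outside the ball `B(0, r)` whose power received
at `y` exceeds `Γ`. -/
def nW0 (y : Plane) (r Γ : ℝ) : ℝ :=
  p.lamW * ∫ x in (Metric.closedBall (0 : Plane) r)ᶜ,
    Real.exp (-p.mu * (Γ / p.powW) * p.pathLoss ‖x - y‖)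

/-- `N₀^L(y, r, Γ)`: mean number of eNBs outside the ball `B(0, r)` whose power received
at `y` exceeds `Γ`. -/
def nL0 (y : Plane) (r Γ : ℝ) : ℝ :=
  p.lamL * ∫ x in (Metric.closedBall (0 : Plane) r)ᶜ,
    Real.exp (-p.mu * (Γ / p.powL) * p.pathLoss ‖x - y‖)

/-- `N₁^L(r, Γ) = N₀^L((r, 0), r, Γ)`. -/
def nL1 (r Γ : ℝ) : ℝ := p.nL0 !₂[r, 0] r Γ

/-- `N₂^W(r) = N₀^W((r, 0), r, Γ_cs)`. -/
def nW2 (r : ℝ) : ℝ := p.nW0 !₂[r, 0] r p.gamCS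

/-- `N₃^W(Γ) = N₀^W(o, 0, Γ)`. -/
def nW3 (Γ : ℝ) : ℝ := p.nW0 0 0 Γ

/-- `N^L = N₀^L(o, 0, Γ_ed)`. -/
def nL : ℝ := p.nL0 0 0 p.gamED

/-- Density `f_W` of the distance from the typical STA to the tagged access point. -/
def fW (r : ℝ) : ℝ := p.lamW * 2 * Real.pi * r * Real.exp (-p.lamW * Real.pi * r ^ 2)

/-- Density `f_L` of the distance from the typical UE to the tagged eNB. -/
def fL (r : ℝ) : ℝ := p.lamL * 2 * Real.pi * r * Real.exp (-p.lamL * Real.pi * r ^ 2)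

end Params

/-- The counting measure `∑ᵢ δ_{xᵢ}` of a sequence of points. -/
def counting {Ω E : Type*} [MeasurableSpace E] (x : ℕ → Ω → E) (ω : Ω) : Measure E :=
  Measure.sum fun i => Measure.dirac (x i ω)

/-- `Φ` is a Poisson point process with intensity measure `ν`: the number of points in a measurable
set of finite intensity is Poisson distributed with mean the intensity of the set, and the numbers
of points in disjoint measurable sets are independent. -/
structure IsPoissonProcess {Ω E : Type*} [MeasurableSpace Ω] [MeasurableSpace E]
    (Φ : Ω → Measure E) (ν : Measure E) (P : Measure Ω) : Prop where
  hasLaw_count : ∀ A : Set E, MeasurableSet A → ν A ≠ ∞ →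
    HasLaw (fun ω => Φ ω A)
      ((poissonMeasure (ν A).toNNReal).map (fun n : ℕ => (n : ℝ≥0∞))) P
  indep_count : ∀ (n : ℕ) (A : Fin n → Set E), (∀ i, MeasurableSet (A i)) →
    Pairwise (fun i j => Disjoint (A i) (A j)) → iIndepFun (fun i ω => Φ ω (A i)) P

/-- A transmitter: `Sum.inl i` is the access point `xᵢ`, `Sum.inr k` is the eNB `y_k`. -/
abbrev Node := ℕ ⊕ ℕ

/-- The random network: access points and eNBs form independent homogeneous Poisson point processes
on the plane, enumerated so that index `0` is the tagged transmitter, i.e. the one closest to the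
origin (where the typical user is); independently of the locations, there are mutually independent
back-off timers and Rayleigh fading variables. The back-off timers are uniform on `[0, 1]` for
access points and uniform on `[a, b]` for eNBs. -/
structure Network (p : Params) (a b : ℝ) {Ω : Type*} [MeasurableSpace Ω] (P : Measure Ω) where
  /-- The access points `xᵢ`. -/
  ap : ℕ → Ω → Plane
  /-- The eNBs `y_k`. -/
  enb : ℕ → Ω → Plane
  /-- The back-off timer of a transmitter. -/
  timer : Node → Ω → ℝ
  /-- `fading u v` is the fading variable of the channel from `u` to `v`. -/
  fading : Node → Node → Ω → ℝ
  measurable_ap : ∀ i, Measurable (ap i)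
  measurable_enb : ∀ k, Measurable (enb k)
  poisson_ap : IsPoissonProcess (counting ap) (ENNReal.ofReal p.lamW • volume) P
  poisson_enb : IsPoissonProcess (counting enb) (ENNReal.ofReal p.lamL • volume) P
  nearest_ap : ∀ᵐ ω ∂P, ∀ i, ‖ap 0 ω‖ ≤ ‖ap i ω‖
  nearest_enb : ∀ᵐ ω ∂P, ∀ k, ‖enb 0 ω‖ ≤ ‖enb k ω‖
  law_timer_ap : ∀ i, HasLaw (timer (Sum.inl i)) (volume[|Set.Icc (0 : ℝ) 1]) P
  law_timer_enb : ∀ k, HasLaw (timer (Sum.inr k)) (volume[|Set.Icc a b]) P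
  law_fading : ∀ u v, HasLaw (fading u v) (expMeasure p.mu) P
  indep_locations : IndepFun (fun ω i => ap i ω) (fun ω k => enb k ω) P
  indep_marks : iIndepFun (fun (m : Node ⊕ Node × Node) ω =>
    Sum.elim (fun u => timer u ω) (fun c => fading c.1 c.2 ω) m) P
  indep_locations_marks : IndepFun
    (fun ω => ((fun i => ap i ω : ℕ → Plane), (fun k => enb k ω : ℕ → Plane)))
    (fun ω => ((fun u => timer u ω : Node → ℝ), (fun u v => fading u v ω : Node → Node → ℝ))) P

/-- `1_{s ≥ t} + 1_{s < t} 1_{g ≤ c}`: a transmitter with timer `t` is not blocked by one with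
timer `s` whose normalized received power is `g`, when the normalized threshold is `c`. -/
def clear (s t g c : ℝ) : ℝ :=
  (if s ≥ t then 1 else 0) + (if s < t then 1 else 0) * (if g ≤ c then 1 else 0)

theorem clear_eq (s t g c : ℝ) : clear s t g c = if s < t → g ≤ c then 1 else 0 := by
  unfold clear
  by_cases h : s < t
  · simp [h, not_le.mpr h]
  · simp [h, not_lt.mp h]

/-- The infinite products below always converge: a product of factors `0` and `1` is `1` if all
factors are `1`, and `0` otherwise. -/
theorem hasProd_ite {ι : Type*} (q : ι → Prop) [DecidablePred q] [Decidable (∀ i, q i)] :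
    HasProd (fun i => if q i then (1 : ℝ) else 0) (if ∀ i, q i then 1 else 0) := by
  by_cases h : ∀ i, q i
  · simp [h]
  · obtain ⟨i, hi⟩ := not_forall.mp h
    rw [if_neg h]
    refine tendsto_const_nhds.congr' ?_
    filter_upwards [Filter.eventually_ge_atTop {i}] with s hs
    exact (Finset.prod_eq_zero (hs (Finset.mem_singleton_self i)) (if_neg hi)).symm

namespace Network

variable {p : Params} {a b : ℝ} {Ω : Type*} [MeasurableSpace Ω] {P : Measure Ω}
  (N : Network p a b P)

/-- Medium access indicator `eᵢ^W` of the access point `xᵢ`. -/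
def eW (i : ℕ) (ω : Ω) : ℝ :=
  (∏' j : {j : ℕ // j ≠ i}, clear (N.timer (Sum.inl j) ω) (N.timer (Sum.inl i) ω)
      (N.fading (Sum.inl j) (Sum.inl i) ω / p.pathLoss ‖N.ap j ω - N.ap i ω‖)
      (p.gamCS / p.powW)) *
    ∏' m : ℕ, clear (N.timer (Sum.inr m) ω) (N.timer (Sum.inl i) ω)
      (N.fading (Sum.inr m) (Sum.inl i) ω / p.pathLoss ‖N.enb m ω - N.ap i ω‖)
      (p.gamED / p.powL)

/-- Medium access indicator `e_k^L` of the eNB `y_k`. -/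
def eL (k : ℕ) (ω : Ω) : ℝ :=
  (∏' j : ℕ, clear (N.timer (Sum.inl j) ω) (N.timer (Sum.inr k) ω)
      (N.fading (Sum.inl j) (Sum.inr k) ω / p.pathLoss ‖N.enb k ω - N.ap j ω‖)
      (p.gamL / p.powW)) *
    ∏' m : {m : ℕ // m ≠ k}, clear (N.timer (Sum.inr m) ω) (N.timer (Sum.inr k) ω)
      (N.fading (Sum.inr m) (Sum.inr k) ω / p.pathLoss ‖N.enb m ω - N.enb k ω‖)
      (p.gamL / p.powL)

end Network

end

end LBT

namespace LBT

open Filter Topology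

/-! ### The function `x ↦ e^{-x}` on `[0, ∞]` -/

/-! Fix the locations and the timer `t` of the tagged transmitter. Another transmitter blocks it
exactly when its timer is below `t` and its fading exceeds a threshold, which has probability `t *
q`, where `q = exp(-μ c ℓ(d))` is the sensing probability at distance `d`. By independence of the
marks the conditional access probability is the product of the factors `1 - t * q`, written as
`expNeg` of a sum of costs `-log (1 - t * q)` (`measure_forall_not_blocked`). The product thus
becomes an exponential functional of the point processes.

Averaging over the other network uses the Laplace functional `E exp(-∑ v) = exp(-∫ (1 - e^{-v})
dν)`: as `1 - e^{-cost} = t * q`, the exponent is linear in `t`. Translation invariance makes it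
independent of the tagged position.

The tagged network has to be seen from its own nearest point. Sum over all points `a` the
exponential of minus the cost at `a`, with infinite cost for any strictly closer point
(`topOnBall`): only the nearest point survives. The Mecke formula turns the mean of this sum into an
integral over `a` of the void probability `exp(-ν(B(0,‖a‖)))` times `exp(-t * mean number sensed
beyond a)` (`lintegral_expNeg_tsum_nearest`, `lintegral_expNeg_blockCost_nearest`). The Mecke
formula itself is derived from the Laplace functional: differentiate in the direction `1_A`, pass
from simple to continuous dependence on the marked point, then take monotone limits to reach
`topOnBall`. Almost sure uniqueness of the nearest point follows from the same identity without
costs.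

Finally `∫₀¹ e^{-t m} dt = (1 - e^{-m}) / m`, invariance under isometries fixing the origin replaces
`a` by `(‖a‖, 0)`, and polar coordinates turn the void probability into the density of the nearest
distance. All of this is done for generic intensities and thresholds
(`measure_nearest_not_blocked_eq`), so that access point and eNB are two instances. -/

/-- `e^{-x}` for `x ∈ [0, ∞]`. -/
noncomputable def expNeg (x : ℝ≥0∞) : ℝ≥0∞ := EReal.exp (-(x : EReal))

@[simp] lemma expNeg_zero : expNeg 0 = 1 := by simp [expNeg]

@[simp] lemma expNeg_top : expNeg ∞ = 0 := by simp [expNeg]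

lemma expNeg_ofReal {r : ℝ} (hr : 0 ≤ r) :
    expNeg (ENNReal.ofReal r) = ENNReal.ofReal (Real.exp (-r)) := by
  rw [expNeg, EReal.coe_ennreal_ofReal, max_eq_left hr, ← EReal.coe_neg, EReal.exp_coe]

lemma expNeg_eq_ofReal {x : ℝ≥0∞} (hx : x ≠ ∞) :
    expNeg x = ENNReal.ofReal (Real.exp (-x.toReal)) := by
  rw [← expNeg_ofReal ENNReal.toReal_nonneg, ENNReal.ofReal_toReal hx]

lemma expNeg_ofReal_neg_log {w : ℝ} (h0 : 0 < w) (h1 : w ≤ 1) :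
    expNeg (ENNReal.ofReal (-Real.log w)) = ENNReal.ofReal w := by
  rw [expNeg_ofReal (neg_nonneg.2 (Real.log_nonpos h0.le h1)), neg_neg, Real.exp_log h0]

lemma expNeg_add (x y : ℝ≥0∞) : expNeg (x + y) = expNeg x * expNeg y := by
  rw [expNeg, expNeg, expNeg, ← EReal.exp_add, EReal.coe_ennreal_add, EReal.neg_add, sub_eq_add_neg]
  · exact Or.inl (EReal.coe_ennreal_ne_bot x)
  · exact Or.inr (EReal.coe_ennreal_ne_bot y)

lemma expNeg_sum {ι : Type*} (s : Finset ι) (f : ι → ℝ≥0∞) :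
    expNeg (∑ i ∈ s, f i) = ∏ i ∈ s, expNeg (f i) := by
  classical
  induction s using Finset.induction_on with
  | empty => simp
  | insert a s ha ih => rw [Finset.sum_insert ha, Finset.prod_insert ha, expNeg_add, ih]

lemma expNeg_antitone : Antitone expNeg := fun x y h => by
  simpa [expNeg] using h

lemma expNeg_le_one (x : ℝ≥0∞) : expNeg x ≤ 1 := by
  simpa using expNeg_antitone (zero_le (a := x))

lemma expNeg_ne_top (x : ℝ≥0∞) : expNeg x ≠ ∞ :=
  ne_top_of_le_ne_top ENNReal.one_ne_top (expNeg_le_one x)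

lemma continuous_expNeg : Continuous expNeg :=
  ENNReal.continuous_exp.comp (continuous_neg.comp continuous_coe_ennreal_ereal)

@[fun_prop] lemma measurable_expNeg : Measurable expNeg := continuous_expNeg.measurable

/-! ### The Laplace functional of a Poisson process -/

lemma lintegral_poissonMeasure (r : ℝ≥0) (f : ℕ → ℝ≥0∞) :
    ∫⁻ n, f n ∂poissonMeasure r =
      ∑' n : ℕ, ENNReal.ofReal (Real.exp (-r) * r ^ n / n.factorial) * f n := by
  simp [poissonMeasure, lintegral_sum_measure]

/-- This is the generating function `E z^N = e^{-(1-z) r}` of the Poisson law at `z = e^{-c}`. -/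
lemma lintegral_expNeg_mul_poissonMeasure (r : ℝ≥0) {c : ℝ≥0∞} (hc : c ≠ ∞) :
    ∫⁻ n, expNeg (c * (n : ℝ≥0∞)) ∂poissonMeasure r = expNeg ((1 - expNeg c) * r) := by
  lift c to ℝ≥0 using hc
  have h1 : expNeg (c : ℝ≥0∞) = ENNReal.ofReal (Real.exp (-c)) := by
    rw [expNeg_eq_ofReal ENNReal.coe_ne_top, ENNReal.coe_toReal]
  have h2 : (0 : ℝ) ≤ (1 - Real.exp (-c)) * r :=
    mul_nonneg (by simp) r.coe_nonneg
  have h3 : (1 - expNeg (c : ℝ≥0∞)) * r = ENNReal.ofReal ((1 - Real.exp (-c)) * r) := by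
    rw [h1, ENNReal.ofReal_mul' r.coe_nonneg, ENNReal.ofReal_sub _ (Real.exp_pos _).le,
      ENNReal.ofReal_one, ENNReal.ofReal_coe_nnreal]
  rw [lintegral_poissonMeasure, h3, expNeg_ofReal h2]
  have hs : HasSum (fun n : ℕ => Real.exp (-r) * ((r * Real.exp (-c)) ^ n / n.factorial))
      (Real.exp (-r) * Real.exp (r * Real.exp (-c))) := by
    have := NormedSpace.expSeries_div_hasSum_exp (𝔸 := ℝ) ((r : ℝ) * Real.exp (-c))
    rw [← Real.exp_eq_exp_ℝ] at this
    exact this.mul_left _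
  have h4 : Real.exp (-((1 - Real.exp (-c)) * r)) =
      Real.exp (-r) * Real.exp (r * Real.exp (-c)) := by
    rw [← Real.exp_add]; ring_nf
  rw [h4, ← hs.tsum_eq, ENNReal.ofReal_tsum_of_nonneg (fun n => by positivity) hs.summable]
  congr 1 with n
  have h5 : (c : ℝ≥0∞) * (n : ℝ≥0∞) = ENNReal.ofReal (c * n) := by
    rw [ENNReal.ofReal_mul c.coe_nonneg, ENNReal.ofReal_coe_nnreal, ENNReal.ofReal_natCast]
  rw [h5, expNeg_ofReal (by positivity), ← ENNReal.ofReal_mul (by positivity)]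
  congr 1
  rw [mul_pow, ← Real.exp_nat_mul]
  ring_nf

lemma lintegral_natCast_poissonMeasure_ne_top (r : ℝ≥0) :
    ∫⁻ n, (n : ℝ≥0∞) ∂poissonMeasure r ≠ ∞ := by
  rw [lintegral_poissonMeasure]
  have hs : Summable (fun n : ℕ => Real.exp (-r) * (r ^ n / n.factorial * n)) := by
    refine Summable.mul_left _ ((summable_nat_add_iff 1).1 ?_)
    refine ((Real.summable_pow_div_factorial (r : ℝ)).mul_left (r : ℝ)).congr fun n => ?_
    rw [Nat.factorial_succ]
    push_cast
    field_simp
    ring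
  have : ∀ n : ℕ, ENNReal.ofReal (Real.exp (-r) * r ^ n / n.factorial) * (n : ℝ≥0∞) =
      ENNReal.ofReal (Real.exp (-r) * (r ^ n / n.factorial * n)) := fun n => by
    rw [← ENNReal.ofReal_natCast n, ← ENNReal.ofReal_mul (by positivity)]
    ring_nf
  simp_rw [this]
  rw [← ENNReal.ofReal_tsum_of_nonneg (fun n => by positivity) hs]
  exact ENNReal.ofReal_ne_top

lemma lintegral_counting {Ω E : Type*} [MeasurableSpace E] (x : ℕ → Ω → E) (ω : Ω)
    {v : E → ℝ≥0∞} (hv : Measurable v) :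
    ∫⁻ y, v y ∂counting x ω = ∑' i, v (x i ω) := by
  simp only [counting, lintegral_sum_measure, lintegral_dirac' _ hv]

section Poisson

variable {Ω E : Type*} [MeasurableSpace Ω] [MeasurableSpace E] {Φ : Ω → Measure E} {ν : Measure E}
  {P : Measure Ω}

lemma measurable_counting {x : ℕ → Ω → E} (hx : ∀ i, Measurable (x i)) :
    Measurable (counting x) := by
  refine Measure.measurable_of_measurable_coe _ fun A hA => ?_
  simp only [counting, Measure.sum_apply _ hA, Measure.dirac_apply' _ hA]
  exact Measurable.tsum fun i => (measurable_one.indicator hA).comp (hx i)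

lemma IsPoissonProcess.lintegral_expNeg_mul_count (h : IsPoissonProcess Φ ν P) {A : Set E}
    (hA : MeasurableSet A) (hνA : ν A ≠ ∞) {c : ℝ≥0∞} (hc : c ≠ ∞) :
    ∫⁻ ω, expNeg (c * Φ ω A) ∂P = expNeg ((1 - expNeg c) * ν A) := by
  have hm : Measurable fun z : ℝ≥0∞ => expNeg (c * z) := by fun_prop
  rw [(h.hasLaw_count A hA hνA).lintegral_comp (f := fun z => expNeg (c * z)) hm.aemeasurable,
    lintegral_map hm (by fun_prop), lintegral_expNeg_mul_poissonMeasure _ hc,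
    ENNReal.coe_toNNReal hνA]

/-- The count in `A` is the dominating function in the limits behind the Mecke formula. -/
lemma IsPoissonProcess.lintegral_count_ne_top (h : IsPoissonProcess Φ ν P) {A : Set E}
    (hA : MeasurableSet A) (hνA : ν A ≠ ∞) : ∫⁻ ω, Φ ω A ∂P ≠ ∞ := by
  rw [(h.hasLaw_count A hA hνA).lintegral_comp (f := fun z => z) aemeasurable_id,
    lintegral_map (f := fun z => z) measurable_id (by fun_prop)]
  exact lintegral_natCast_poissonMeasure_ne_top _

lemma IsPoissonProcess.ae_count_ne_top (h : IsPoissonProcess Φ ν P) (hΦ : Measurable Φ) {A : Set E}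
    (hA : MeasurableSet A) (hνA : ν A ≠ ∞) : ∀ᵐ ω ∂P, Φ ω A ≠ ∞ := by
  filter_upwards [ae_lt_top ((Measure.measurable_coe hA).comp hΦ) (h.lintegral_count_ne_top hA hνA)]
    with ω hω using hω.ne

/-- The fibres of `s` are disjoint, so their counts are independent and the exponential of the sum
factors into one-variable Poisson transforms. -/
lemma IsPoissonProcess.lintegral_expNeg_simpleFunc (h : IsPoissonProcess Φ ν P) (hΦ : Measurable Φ)
    (s : SimpleFunc E ℝ≥0∞) (hs : s.FinMeasSupp ν) (hs' : ∀ y, s y ≠ ∞) :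
    ∫⁻ ω, expNeg (∫⁻ y, s y ∂Φ ω) ∂P = expNeg (∫⁻ y, (1 - expNeg (s y)) ∂ν) := by
  set e := s.range.equivFin
  have hind := h.indep_count _ (fun i => s ⁻¹' {(e.symm i : ℝ≥0∞)})
    (fun i => s.measurableSet_fiber _) (fun i j hij => by
      refine Set.disjoint_left.2 fun y hy hy' => hij ?_
      simp only [Set.mem_preimage, Set.mem_singleton_iff] at hy hy'
      exact e.symm.injective (Subtype.ext (hy.symm.trans hy')))
  have hL : ∀ μ : Measure E, ∫⁻ y, s y ∂μ =
      ∑ i, (e.symm i : ℝ≥0∞) * μ (s ⁻¹' {(e.symm i : ℝ≥0∞)}) := fun μ => by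
    rw [SimpleFunc.lintegral_eq_lintegral, SimpleFunc.lintegral, ← Finset.sum_coe_sort]
    exact (Equiv.sum_comp e.symm _).symm
  have hR : ∫⁻ y, (1 - expNeg (s y)) ∂ν =
      ∑ i, (1 - expNeg (e.symm i : ℝ≥0∞)) * ν (s ⁻¹' {(e.symm i : ℝ≥0∞)}) := by
    change ∫⁻ y, s.map (fun c => 1 - expNeg c) y ∂ν = _
    rw [SimpleFunc.lintegral_eq_lintegral, SimpleFunc.map_lintegral, ← Finset.sum_coe_sort]
    exact (Equiv.sum_comp e.symm _).symm
  simp_rw [hL, hR, expNeg_sum]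
  rw [lintegral_prod_eq_prod_lintegral_of_indepFun Finset.univ
    (fun i ω => expNeg ((e.symm i : ℝ≥0∞) * Φ ω (s ⁻¹' {(e.symm i : ℝ≥0∞)})))
    (hind.comp (fun i z => expNeg ((e.symm i : ℝ≥0∞) * z)) fun i => by fun_prop)
    (fun i => measurable_expNeg.comp
      (((Measure.measurable_coe (s.measurableSet_fiber _)).comp hΦ).const_mul _))]
  refine Finset.prod_congr rfl fun i _ => ?_
  obtain ⟨y, hy⟩ := SimpleFunc.mem_range.1 (e.symm i).2
  -- The fibre over `0` may have infinite intensity, but its factor is `1`.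
  by_cases h0 : (e.symm i : ℝ≥0∞) = 0
  · have := hind.isProbabilityMeasure
    simp [h0]
  · exact h.lintegral_expNeg_mul_count (s.measurableSet_fiber _)
      ((SimpleFunc.finMeasSupp_iff.1 hs _ h0).ne) (hy ▸ hs' y)

/-- The Laplace functional of a Poisson process. -/
theorem IsPoissonProcess.lintegral_expNeg_lintegral [SigmaFinite ν] [IsProbabilityMeasure P]
    (h : IsPoissonProcess Φ ν P) (hΦ : Measurable Φ) {v : E → ℝ≥0∞} (hv : Measurable v) :
    ∫⁻ ω, expNeg (∫⁻ y, v y ∂Φ ω) ∂P = expNeg (∫⁻ y, (1 - expNeg (v y)) ∂ν) := by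
  -- Cutting off by the spanning sets gives each approximant a support of finite intensity.
  set s : ℕ → SimpleFunc E ℝ≥0∞ := fun n =>
    (SimpleFunc.eapprox v n).restrict (spanningSets ν n) with hs
  have hsv : ∀ n y, s n y = (spanningSets ν n).indicator (SimpleFunc.eapprox v n) y := fun n y =>
    SimpleFunc.restrict_apply _ (measurableSet_spanningSets ν n) y
  have hmono : ∀ y, Monotone fun n => s n y := fun y m n hmn => by
    simp only [hsv]
    refine (Set.indicator_le_indicator_of_subset (monotone_spanningSets ν hmn)
      (fun _ => zero_le) y).trans (Set.indicator_le_indicator ?_)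
    exact SimpleFunc.monotone_eapprox v hmn y
  have hlim : ∀ y, Tendsto (fun n => s n y) atTop (𝓝 (v y)) := fun y => by
    have h1 : Tendsto (fun n => SimpleFunc.eapprox v n y) atTop (𝓝 (v y)) :=
      SimpleFunc.tendsto_eapprox hv y
    refine h1.congr' ?_
    obtain ⟨n, hn⟩ := Set.mem_iUnion.1 ((iUnion_spanningSets ν).symm ▸ Set.mem_univ y)
    filter_upwards [eventually_ge_atTop n] with m hm
    rw [hsv, Set.indicator_of_mem (monotone_spanningSets ν hm hn)]
  have hI : ∀ μ : Measure E, Tendsto (fun n => ∫⁻ y, s n y ∂μ) atTop (𝓝 (∫⁻ y, v y ∂μ)) := fun μ =>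
    lintegral_tendsto_of_tendsto_of_monotone (fun n => (s n).measurable.aemeasurable)
      (ae_of_all _ hmono) (ae_of_all _ hlim)
  have hL : Tendsto (fun n => ∫⁻ ω, expNeg (∫⁻ y, s n y ∂Φ ω) ∂P) atTop
      (𝓝 (∫⁻ ω, expNeg (∫⁻ y, v y ∂Φ ω) ∂P)) := by
    refine tendsto_lintegral_of_dominated_convergence (fun _ => 1) (fun n => ?_)
      (fun n => ae_of_all _ fun ω => expNeg_le_one _) (by simp)
      (ae_of_all _ fun ω => (continuous_expNeg.tendsto _).comp (hI _))
    exact measurable_expNeg.comp ((Measure.measurable_lintegral (s n).measurable).comp hΦ)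
  have hR : Tendsto (fun n => expNeg (∫⁻ y, (1 - expNeg (s n y)) ∂ν)) atTop
      (𝓝 (expNeg (∫⁻ y, (1 - expNeg (v y)) ∂ν))) := by
    refine (continuous_expNeg.tendsto _).comp (lintegral_tendsto_of_tendsto_of_monotone
      (fun n => ?_) (ae_of_all _ fun y m n hmn => ?_) (ae_of_all _ fun y => ?_))
    · exact (measurable_const.sub (measurable_expNeg.comp (s n).measurable)).aemeasurable
    · exact tsub_le_tsub_left (expNeg_antitone (hmono y hmn)) _
    · exact ENNReal.Tendsto.sub tendsto_const_nhds
        ((continuous_expNeg.tendsto _).comp (hlim y)) (Or.inl ENNReal.one_ne_top)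
  refine tendsto_nhds_unique hL (hR.congr fun n => ?_)
  refine (h.lintegral_expNeg_simpleFunc hΦ (s n) ?_ fun y => ?_).symm
  · refine SimpleFunc.finMeasSupp_iff_support.2 (lt_of_le_of_lt (measure_mono ?_)
      (measure_spanningSets_lt_top ν n))
    intro y hy
    by_contra hy'
    exact hy (by rw [hsv, Set.indicator_of_notMem hy'])
  · rw [hsv]
    by_cases hy : y ∈ spanningSets ν n
    · rw [Set.indicator_of_mem hy]; exact (SimpleFunc.eapprox_lt_top v n y).ne
    · rw [Set.indicator_of_notMem hy]; exact ENNReal.zero_ne_top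

end Poisson

/-! ### Campbell–Mecke formulas for a Poisson process -/

lemma one_sub_expNeg_le (b : ℝ≥0∞) : 1 - expNeg b ≤ b := by
  by_cases hb : b = ∞
  · simp [hb]
  rw [expNeg_eq_ofReal hb, ← ENNReal.ofReal_one, ← ENNReal.ofReal_sub _ (Real.exp_pos _).le]
  refine ENNReal.ofReal_le_of_le_toReal ?_
  linarith [Real.add_one_le_exp (-b.toReal)]

lemma mul_inv_one_add_le_one_sub_exp_neg {r : ℝ} (hr : 0 ≤ r) :
    r * (1 + r)⁻¹ ≤ 1 - Real.exp (-r) := by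
  have h1 : 0 < 1 + r := by positivity
  have h3 : Real.exp (-r) ≤ (1 + r)⁻¹ := by
    rw [Real.exp_neg]
    exact inv_anti₀ h1 (by linarith [Real.add_one_le_exp r])
  have h4 : r * (1 + r)⁻¹ = 1 - (1 + r)⁻¹ := by field_simp; ring
  linarith

lemma mul_inv_one_add_le_one_sub_expNeg {b : ℝ≥0∞} (hb : b ≠ ∞) :
    b * (1 + b)⁻¹ ≤ 1 - expNeg b := by
  have hr : 0 ≤ b.toReal := ENNReal.toReal_nonneg
  have h2 : b * (1 + b)⁻¹ = ENNReal.ofReal (b.toReal * (1 + b.toReal)⁻¹) := by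
    rw [ENNReal.ofReal_mul hr, ENNReal.ofReal_inv_of_pos (by positivity),
      ENNReal.ofReal_add zero_le_one hr, ENNReal.ofReal_one, ENNReal.ofReal_toReal hb]
  rw [h2, expNeg_eq_ofReal hb, ← ENNReal.ofReal_one, ← ENNReal.ofReal_sub _ (Real.exp_pos _).le]
  exact ENNReal.ofReal_le_ofReal (mul_inv_one_add_le_one_sub_exp_neg hr)

/-- This encodes that `1 - e^{-b}` has slope `1` at `0`, by squeezing it between `b / (1 + b)` and
`b`; the prefactors `c n` may tend to infinity. -/
lemma tendsto_mul_one_sub_expNeg {c b : ℕ → ℝ≥0∞} {a : ℝ≥0∞} (hb : ∀ n, b n ≠ ∞)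
    (hb0 : Tendsto b atTop (𝓝 0)) (hcb : Tendsto (fun n => c n * b n) atTop (𝓝 a)) :
    Tendsto (fun n => c n * (1 - expNeg (b n))) atTop (𝓝 a) := by
  have h1 : Tendsto (fun n => (1 + b n)⁻¹) atTop (𝓝 1) := by
    have := ((continuous_inv (G := ℝ≥0∞)).tendsto (1 + 0)).comp (hb0.const_add 1)
    simpa [Function.comp_def] using this
  have h2 : Tendsto (fun n => c n * b n * (1 + b n)⁻¹) atTop (𝓝 a) := by
    have := ENNReal.Tendsto.mul hcb (Or.inr ENNReal.one_ne_top) h1 (Or.inl one_ne_zero)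
    simpa using this
  refine tendsto_of_tendsto_of_tendsto_of_le_of_le h2 hcb (fun n => ?_) fun n => ?_
  · simp only [mul_assoc]
    gcongr
    exact mul_inv_one_add_le_one_sub_expNeg (hb n)
  · exact mul_le_mul_right (one_sub_expNeg_le _) _

lemma tendsto_natCast_mul_one_sub_expNeg {z : ℝ≥0∞} (hz : z ≠ ∞) :
    Tendsto (fun n : ℕ => ((n : ℝ≥0∞) + 1) * (1 - expNeg (((n : ℝ≥0∞) + 1)⁻¹ * z))) atTop
      (𝓝 z) := by
  have h0 : ∀ n : ℕ, (n : ℝ≥0∞) + 1 ≠ 0 := fun n => by simp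
  have h1 : ∀ n : ℕ, (n : ℝ≥0∞) + 1 ≠ ∞ := fun n => by simp
  refine tendsto_mul_one_sub_expNeg (fun n => ENNReal.mul_ne_top (ENNReal.inv_ne_top.2 (h0 n)) hz)
    ?_ ?_
  · have h2 : Tendsto (fun n : ℕ => ((n : ℝ≥0∞) + 1)⁻¹) atTop (𝓝 0) := by
      have := (tendsto_add_atTop_iff_nat 1).2 ENNReal.tendsto_inv_nat_nhds_zero
      simpa using this
    simpa using ENNReal.Tendsto.mul_const h2 (Or.inr hz)
  · simp_rw [← mul_assoc, ENNReal.mul_inv_cancel (h0 _) (h1 _), one_mul]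
    exact tendsto_const_nhds

lemma lintegral_comp_simpleFunc {α β : Type*} [MeasurableSpace α] (μ : Measure α)
    (c : SimpleFunc α β) {H : β → α → ℝ≥0∞} (hH : ∀ k, Measurable (H k)) :
    ∫⁻ x, H (c x) x ∂μ = ∑ k ∈ c.range, ∫⁻ x in c ⁻¹' {k}, H k x ∂μ := by
  classical
  have h1 : ∀ x, H (c x) x = ∑ k ∈ c.range, (c ⁻¹' {k}).indicator (H k) x := fun x => by
    rw [Finset.sum_eq_single_of_mem (c x) (c.mem_range_self x)]
    · rw [Set.indicator_of_mem (by simp)]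
    · intro k _ hk
      exact Set.indicator_of_notMem (by simpa using hk.symm) _
  simp_rw [h1]
  rw [lintegral_finsetSum _ fun k _ => (hH k).indicator (c.measurableSet_fiber k)]
  exact Finset.sum_congr rfl fun k _ => lintegral_indicator (c.measurableSet_fiber k) _

section Mecke

variable {Ω E : Type*} [MeasurableSpace Ω] [MeasurableSpace E] {Φ : Ω → Measure E} {ν : Measure E}
  {P : Measure Ω}

/-- Apply the Laplace functional to `s * 1_A + v` and differentiate at `s = 0`: on the left this
brings down the factor `Φ ω A`, on the right the integral of `e^{-v}` over `A`. The derivative is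
taken as a limit of difference quotients with `s = 1 / (n + 1)`. -/
lemma IsPoissonProcess.lintegral_count_mul_expNeg [SigmaFinite ν] [IsProbabilityMeasure P]
    (h : IsPoissonProcess Φ ν P) (hΦ : Measurable Φ) {A : Set E} (hA : MeasurableSet A)
    (hνA : ν A ≠ ∞) {v : E → ℝ≥0∞} (hv : Measurable v) :
    ∫⁻ ω, Φ ω A * expNeg (∫⁻ y, v y ∂Φ ω) ∂P =
      (∫⁻ y in A, expNeg (v y) ∂ν) * expNeg (∫⁻ y, (1 - expNeg (v y)) ∂ν) := by
  set I := ∫⁻ y, (1 - expNeg (v y)) ∂ν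
  set a := ∫⁻ y in A, expNeg (v y) ∂ν
  have ha : a ≠ ∞ := ne_top_of_le_ne_top hνA ((lintegral_mono fun y => expNeg_le_one (v y)).trans
    (by simp))
  have hmA : Measurable fun ω => Φ ω A := (Measure.measurable_coe hA).comp hΦ
  have hmv : Measurable fun ω => expNeg (∫⁻ y, v y ∂Φ ω) :=
    measurable_expNeg.comp ((Measure.measurable_lintegral hv).comp hΦ)
  have key : ∀ s : ℝ≥0∞, ∫⁻ ω, (1 - expNeg (s * Φ ω A)) * expNeg (∫⁻ y, v y ∂Φ ω) ∂P =
      (1 - expNeg (a * (1 - expNeg s))) * expNeg I := fun s => by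
    have h1 : ∀ ω, expNeg (s * Φ ω A) * expNeg (∫⁻ y, v y ∂Φ ω) =
        expNeg (∫⁻ y, (A.indicator (fun _ => s) y + v y) ∂Φ ω) := fun ω => by
      rw [lintegral_add_left (measurable_const.indicator hA), lintegral_indicator hA,
        setLIntegral_const, expNeg_add]
    -- On `A` this is `1 - e^{-s} e^{-v} = e^{-v} (1 - e^{-s}) + (1 - e^{-v})`.
    have h2 : ∫⁻ y, (1 - expNeg (A.indicator (fun _ => s) y + v y)) ∂ν =
        a * (1 - expNeg s) + I := by
      have : ∀ y, 1 - expNeg (A.indicator (fun _ => s) y + v y) =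
          A.indicator (fun y => expNeg (v y) * (1 - expNeg s)) y + (1 - expNeg (v y)) := fun y => by
        by_cases hy : y ∈ A
        · rw [Set.indicator_of_mem hy, Set.indicator_of_mem hy, expNeg_add,
            ENNReal.mul_sub fun _ _ => expNeg_ne_top _, mul_one, mul_comm,
            ← ENNReal.toReal_eq_toReal_iff' (by simp)
              (ENNReal.add_ne_top.2 ⟨ENNReal.sub_ne_top (expNeg_ne_top _), by simp⟩),
            ENNReal.toReal_add (ENNReal.sub_ne_top (expNeg_ne_top _)) (by simp),
            ENNReal.toReal_sub_of_le (mul_le_one' (expNeg_le_one _) (expNeg_le_one _)) (by simp),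
            ENNReal.toReal_sub_of_le (mul_le_of_le_one_right' (expNeg_le_one _)) (expNeg_ne_top _),
            ENNReal.toReal_sub_of_le (expNeg_le_one _) (by simp)]
          ring
        · rw [Set.indicator_of_notMem hy, Set.indicator_of_notMem hy, zero_add, zero_add]
      simp_rw [this]
      rw [lintegral_add_right _ (by fun_prop), lintegral_indicator hA,
        lintegral_mul_const _ (by fun_prop)]
    simp_rw [ENNReal.sub_mul fun _ _ => expNeg_ne_top _, one_mul]
    have hms : Measurable fun ω => expNeg (s * Φ ω A) * expNeg (∫⁻ y, v y ∂Φ ω) :=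
      (measurable_expNeg.comp (hmA.const_mul s)).mul hmv
    rw [lintegral_sub hms
      (ne_top_of_le_ne_top ENNReal.one_ne_top ?_)
      (ae_of_all _ fun ω => mul_le_of_le_one_left' (expNeg_le_one _))]
    · simp_rw [h1]
      rw [h.lintegral_expNeg_lintegral hΦ hv, h.lintegral_expNeg_lintegral hΦ
        (v := fun y => A.indicator (fun _ => s) y + v y)
        ((measurable_const.indicator hA).add hv), h2, expNeg_add]
    · refine (lintegral_mono fun ω => mul_le_one' (expNeg_le_one _) (expNeg_le_one _)).trans ?_
      simp
  have hL : Tendsto (fun n : ℕ => ∫⁻ ω, ((n : ℝ≥0∞) + 1) *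
      ((1 - expNeg (((n : ℝ≥0∞) + 1)⁻¹ * Φ ω A)) * expNeg (∫⁻ y, v y ∂Φ ω)) ∂P) atTop
      (𝓝 (∫⁻ ω, Φ ω A * expNeg (∫⁻ y, v y ∂Φ ω) ∂P)) := by
    refine tendsto_lintegral_of_dominated_convergence (fun ω => Φ ω A) (fun n => by fun_prop)
      (fun n => ae_of_all _ fun ω => ?_) (h.lintegral_count_ne_top hA hνA) ?_
    · calc _ ≤ ((n : ℝ≥0∞) + 1) * ((((n : ℝ≥0∞) + 1)⁻¹ * Φ ω A) * 1) :=
            mul_le_mul' le_rfl (mul_le_mul' (one_sub_expNeg_le _) (expNeg_le_one _))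
        _ = _ := by rw [mul_one, ← mul_assoc, ENNReal.mul_inv_cancel (by simp) (by simp), one_mul]
    · filter_upwards [h.ae_count_ne_top hΦ hA hνA] with ω hω
      simp_rw [← mul_assoc]
      exact ENNReal.Tendsto.mul_const (tendsto_natCast_mul_one_sub_expNeg hω)
        (Or.inr (expNeg_ne_top _))
  refine tendsto_nhds_unique hL ?_
  have h3 : ∀ n : ℕ, ∫⁻ ω, ((n : ℝ≥0∞) + 1) *
      ((1 - expNeg (((n : ℝ≥0∞) + 1)⁻¹ * Φ ω A)) * expNeg (∫⁻ y, v y ∂Φ ω)) ∂P =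
      ((n : ℝ≥0∞) + 1) * (1 - expNeg (a * (1 - expNeg ((n : ℝ≥0∞) + 1)⁻¹))) * expNeg I :=
      fun n => by
    rw [lintegral_const_mul _ (by fun_prop), key, mul_assoc]
  simp_rw [h3]
  refine ENNReal.Tendsto.mul_const (tendsto_mul_one_sub_expNeg (fun n => ?_) ?_ ?_)
    (Or.inr (expNeg_ne_top _))
  · exact ENNReal.mul_ne_top ha (by simp)
  · have h2 : Tendsto (fun n : ℕ => ((n : ℝ≥0∞) + 1)⁻¹) atTop (𝓝 0) := by
      have := (tendsto_add_atTop_iff_nat 1).2 ENNReal.tendsto_inv_nat_nhds_zero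
      simpa using this
    have h4 : Tendsto (fun n : ℕ => 1 - expNeg ((n : ℝ≥0∞) + 1)⁻¹) atTop (𝓝 0) :=
      tendsto_of_tendsto_of_tendsto_of_le_of_le tendsto_const_nhds h2 (fun _ => zero_le)
        fun n => one_sub_expNeg_le _
    simpa using ENNReal.Tendsto.const_mul h4 (Or.inr ha)
  · have := ENNReal.Tendsto.const_mul (tendsto_natCast_mul_one_sub_expNeg ENNReal.one_ne_top)
      (Or.inr ha)
    refine (by simpa using this : Tendsto _ _ (𝓝 a)).congr fun n => ?_
    ring

/-- The Mecke formula for exponential functionals depending continuously on the marked point. -/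
lemma IsPoissonProcess.lintegral_setLIntegral_expNeg_of_continuous [PseudoEMetricSpace E]
    [SecondCountableTopology E] [OpensMeasurableSpace E] [Nonempty E]
    [SigmaFinite ν] [IsProbabilityMeasure P]
    (h : IsPoissonProcess Φ ν P) (hΦ : Measurable Φ) {A : Set E} (hA : MeasurableSet A)
    (hνA : ν A ≠ ∞) {B : Set E} (hB : MeasurableSet B) (hνB : ν B ≠ ∞)
    {v : E → E → ℝ≥0∞} (hv : Measurable (Function.uncurry v)) (hc : ∀ y, Continuous fun x => v x y)
    {C : ℝ≥0∞} (hC : C ≠ ∞) (hvB : ∀ x y, v x y ≤ B.indicator (fun _ => C) y) :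
    ∫⁻ ω, ∫⁻ x in A, expNeg (∫⁻ y, v x y ∂Φ ω) ∂Φ ω ∂P =
      ∫⁻ x in A, expNeg (v x x) * expNeg (∫⁻ y, (1 - expNeg (v x y)) ∂ν) ∂ν := by
  have hv' : ∀ x, Measurable (v x) := fun x => hv.comp measurable_prodMk_left
  -- Round the marked point to finitely many values: on each fibre of `c n` the first argument of
  -- `v` is frozen, and the formula for counts applies.
  set c : ℕ → SimpleFunc E E := fun n =>
    SimpleFunc.approxOn id measurable_id Set.univ (Classical.arbitrary E) (Set.mem_univ _) n
  have hcx : ∀ x, Tendsto (fun n => c n x) atTop (𝓝 x) := fun x =>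
    SimpleFunc.tendsto_approxOn measurable_id (Set.mem_univ _) (by simp)
  have hstep : ∀ n, ∫⁻ ω, ∫⁻ x in A, expNeg (∫⁻ y, v (c n x) y ∂Φ ω) ∂Φ ω ∂P =
      ∫⁻ x in A, expNeg (v (c n x) x) * expNeg (∫⁻ y, (1 - expNeg (v (c n x) y)) ∂ν) ∂ν :=
      fun n => by
    have hm : ∀ k, MeasurableSet (c n ⁻¹' {k} ∩ A) :=
      fun k => ((c n).measurableSet_fiber k).inter hA
    have hf : ∀ k, ν (c n ⁻¹' {k} ∩ A) ≠ ∞ := fun k =>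
      ne_top_of_le_ne_top hνA (measure_mono Set.inter_subset_right)
    rw [lintegral_comp_simpleFunc (ν.restrict A) (c n) (H := fun k x =>
      expNeg (v k x) * expNeg (∫⁻ y, (1 - expNeg (v k y)) ∂ν))
      fun k => (measurable_expNeg.comp (hv' k)).mul_const _]
    have h1 : ∀ ω, ∫⁻ x in A, expNeg (∫⁻ y, v (c n x) y ∂Φ ω) ∂Φ ω =
        ∑ k ∈ (c n).range, Φ ω (c n ⁻¹' {k} ∩ A) * expNeg (∫⁻ y, v k y ∂Φ ω) := fun ω => by
      rw [lintegral_comp_simpleFunc ((Φ ω).restrict A) (c n) (H := fun k _ =>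
        expNeg (∫⁻ y, v k y ∂Φ ω)) fun k => measurable_const]
      refine Finset.sum_congr rfl fun k _ => ?_
      rw [Measure.restrict_restrict ((c n).measurableSet_fiber k), setLIntegral_const, mul_comm]
    simp_rw [h1]
    rw [lintegral_finsetSum]
    · refine Finset.sum_congr rfl fun k _ => ?_
      rw [h.lintegral_count_mul_expNeg hΦ (hm k) (hf k) (hv' k),
        Measure.restrict_restrict ((c n).measurableSet_fiber k),
        lintegral_mul_const _ (show Measurable fun y => expNeg (v k y) from
          measurable_expNeg.comp (hv' k))]
    · exact fun k _ => ((Measure.measurable_coe (hm k)).comp hΦ).mul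
        (measurable_expNeg.comp ((Measure.measurable_lintegral (hv' k)).comp hΦ))
  -- The bound by `C` on `B` is integrable against any measure finite on `B`; this covers almost
  -- every realization of the process.
  have hlimv : ∀ (μ : Measure E) x, μ B ≠ ∞ →
      Tendsto (fun n => ∫⁻ y, v (c n x) y ∂μ) atTop (𝓝 (∫⁻ y, v x y ∂μ)) := fun μ x hμ => by
    refine tendsto_lintegral_of_dominated_convergence (B.indicator fun _ => C)
      (fun n => hv' _) (fun n => ae_of_all _ fun y => hvB _ y) ?_
      (ae_of_all _ fun y => ((hc y).tendsto x).comp (hcx x))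
    rw [lintegral_indicator hB, setLIntegral_const]
    exact ENNReal.mul_ne_top hC hμ
  have hL : Tendsto (fun n => ∫⁻ ω, ∫⁻ x in A, expNeg (∫⁻ y, v (c n x) y ∂Φ ω) ∂Φ ω ∂P) atTop
      (𝓝 (∫⁻ ω, ∫⁻ x in A, expNeg (∫⁻ y, v x y ∂Φ ω) ∂Φ ω ∂P)) := by
    refine tendsto_lintegral_of_dominated_convergence (fun ω => Φ ω A) (fun n => ?_)
      (fun n => ae_of_all _ fun ω => ?_) (h.lintegral_count_ne_top hA hνA) ?_
    · have h1 : ∀ ω, ∫⁻ x in A, expNeg (∫⁻ y, v (c n x) y ∂Φ ω) ∂Φ ω =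
          ∑ k ∈ (c n).range, Φ ω (c n ⁻¹' {k} ∩ A) * expNeg (∫⁻ y, v k y ∂Φ ω) := fun ω => by
        rw [lintegral_comp_simpleFunc ((Φ ω).restrict A) (c n) (H := fun k _ =>
          expNeg (∫⁻ y, v k y ∂Φ ω)) fun k => measurable_const]
        refine Finset.sum_congr rfl fun k _ => ?_
        rw [Measure.restrict_restrict ((c n).measurableSet_fiber k), setLIntegral_const, mul_comm]
      simp_rw [h1]
      exact Finset.measurable_sum _ fun k _ =>
        ((Measure.measurable_coe (((c n).measurableSet_fiber k).inter hA)).comp hΦ).mul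
        (measurable_expNeg.comp ((Measure.measurable_lintegral (hv' k)).comp hΦ))
    · exact (lintegral_mono fun y => expNeg_le_one _).trans (by simp)
    · filter_upwards [h.ae_count_ne_top hΦ hA hνA, h.ae_count_ne_top hΦ hB hνB] with ω hωA hωB
      refine tendsto_lintegral_of_dominated_convergence (fun _ => 1) (fun n => ?_)
        (fun n => ae_of_all _ fun x => expNeg_le_one _) (by simpa using hωA)
        (ae_of_all _ fun x => (continuous_expNeg.tendsto _).comp (hlimv _ x hωB))
      exact ((c n).map fun k => expNeg (∫⁻ y, v k y ∂Φ ω)).measurable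
  refine tendsto_nhds_unique hL ?_
  simp_rw [hstep]
  refine tendsto_lintegral_of_dominated_convergence (fun _ => 1) (fun n => ?_)
    (fun n => ae_of_all _ fun x => mul_le_one' (expNeg_le_one _) (expNeg_le_one _))
    (by simpa using hνA) (ae_of_all _ fun x => ?_)
  · exact (measurable_expNeg.comp (hv.comp ((c n).measurable.prodMk measurable_id))).mul
      ((c n).map fun k => expNeg (∫⁻ y, (1 - expNeg (v k y)) ∂ν)).measurable
  · refine ENNReal.Tendsto.mul
        ((continuous_expNeg.tendsto _).comp (((hc x).tendsto x).comp (hcx x)))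
      (Or.inr (expNeg_ne_top _)) ((continuous_expNeg.tendsto _).comp ?_)
      (Or.inr (expNeg_ne_top _))
    refine tendsto_lintegral_of_dominated_convergence (B.indicator fun _ => 1)
      (fun n => measurable_const.sub (measurable_expNeg.comp (hv' _)))
      (fun n => ae_of_all _ fun y => ?_) ?_ (ae_of_all _ fun y => ?_)
    · by_cases hy : y ∈ B
      · simp [hy]
      · have : v (c n x) y = 0 := by simpa [hy] using hvB (c n x) y
        simp [this]
    · simpa [lintegral_indicator hB] using hνB
    · exact ENNReal.Tendsto.sub tendsto_const_nhds ((continuous_expNeg.tendsto _).comp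
        (((hc y).tendsto x).comp (hcx x))) (Or.inl ENNReal.one_ne_top)

end Mecke

/-! ### The point of a Poisson process that is nearest to the origin -/

lemma measurable_expNeg_lintegral_counting {Ω E : Type*} [MeasurableSpace E] (x : ℕ → Ω → E)
    {v : E → E → ℝ≥0∞}
    (hv : Measurable (Function.uncurry v)) (ω : Ω) :
    Measurable fun a => expNeg (∫⁻ y, v a y ∂counting x ω) := by
  have hv' : ∀ a, Measurable (v a) := fun a => hv.comp measurable_prodMk_left
  simp_rw [lintegral_counting x ω (hv' _)]
  exact measurable_expNeg.comp (Measurable.tsum fun j => hv.comp measurable_prodMk_right)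

/-- The integrand depends on `ω` as well as on the integration point; rewriting everything as a
double series over indices makes measurability visible. -/
lemma measurable_lintegral_counting_expNeg {Ω E : Type*} [MeasurableSpace Ω] [MeasurableSpace E]
    {x : ℕ → Ω → E} (hx : ∀ i, Measurable (x i)) {A : Set E} (hA : MeasurableSet A)
    {v : E → E → ℝ≥0∞} (hv : Measurable (Function.uncurry v)) :
    Measurable fun ω => ∫⁻ a in A, expNeg (∫⁻ y, v a y ∂counting x ω) ∂counting x ω := by
  have hv' : ∀ a, Measurable (v a) := fun a => hv.comp measurable_prodMk_left
  have h : ∀ ω, ∫⁻ a in A, expNeg (∫⁻ y, v a y ∂counting x ω) ∂counting x ω =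
      ∑' i, A.indicator 1 (x i ω) * expNeg (∑' j, v (x i ω) (x j ω)) := fun ω => by
    rw [← lintegral_indicator hA, lintegral_counting x ω
      ((measurable_expNeg_lintegral_counting _ hv ω).indicator hA)]
    congr 1 with i
    by_cases hi : x i ω ∈ A
    · simp [hi, lintegral_counting x ω (hv' _)]
    · simp [hi]
  simp_rw [h]
  refine Measurable.tsum fun i => ((measurable_one.indicator hA).comp (hx i)).mul
    (measurable_expNeg.comp (Measurable.tsum fun j => hv.comp ((hx i).prodMk (hx j))))

section Nearest

variable {Ω E : Type*} [MeasurableSpace Ω] [NormedAddCommGroup E] [MeasurableSpace E]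

/-- The function `y ↦ V x y`, made infinite on the open ball of radius `‖x‖`. -/
noncomputable def topOnBall (V : E → E → ℝ≥0∞) (x y : E) : ℝ≥0∞ :=
  V x y + (if ‖y‖ < ‖x‖ then ∞ else 0)

/-- Bounded approximations of `topOnBall` that are continuous in the first variable. -/
noncomputable def topOnBallApprox (V : E → E → ℝ≥0∞) (k : ℕ) (x y : E) : ℝ≥0∞ :=
  (Metric.closedBall (0 : E) k).indicator
    (fun y => V x y + min (k : ℝ≥0∞) (k * ENNReal.ofReal (‖x‖ - ‖y‖))) y

omit [MeasurableSpace E] in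
lemma topOnBallApprox_mono (V : E → E → ℝ≥0∞) (x y : E) :
    Monotone fun k => topOnBallApprox V k x y := fun k l hkl => by
  have h : (k : ℝ≥0∞) ≤ l := by exact_mod_cast hkl
  refine (Set.indicator_le_indicator_of_subset
    (Metric.closedBall_subset_closedBall (by exact_mod_cast hkl)) (fun _ => zero_le) y).trans
    (Set.indicator_le_indicator ?_)
  exact add_le_add_right (min_le_min h (mul_le_mul_left h _)) _

omit [MeasurableSpace E] in
lemma tendsto_topOnBallApprox (V : E → E → ℝ≥0∞) (x y : E) :
    Tendsto (fun k => topOnBallApprox V k x y) atTop (𝓝 (topOnBall V x y)) := by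
  have h1 : Tendsto (fun k : ℕ => V x y + min (k : ℝ≥0∞) (k * ENNReal.ofReal (‖x‖ - ‖y‖))) atTop
      (𝓝 (topOnBall V x y)) := by
    refine Tendsto.const_add _ ?_
    split_ifs with h
    · have hne : ENNReal.ofReal (‖x‖ - ‖y‖) ≠ 0 := by simpa using h
      have := ENNReal.tendsto_nat_nhds_top.min
        (ENNReal.Tendsto.mul_const ENNReal.tendsto_nat_nhds_top (Or.inl (ENNReal.top_ne_zero))
          (b := ENNReal.ofReal (‖x‖ - ‖y‖)))
      rwa [ENNReal.top_mul hne, min_self] at this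
    · have : ENNReal.ofReal (‖x‖ - ‖y‖) = 0 := ENNReal.ofReal_eq_zero.2 (by linarith [not_lt.1 h])
      simp [this]
  refine h1.congr' ?_
  obtain ⟨n, hn⟩ := exists_nat_ge ‖y‖
  filter_upwards [eventually_ge_atTop n] with k hk
  have hy : y ∈ Metric.closedBall (0 : E) k := by
    rw [mem_closedBall_zero_iff]
    exact hn.trans (by exact_mod_cast hk)
  rw [topOnBallApprox, Set.indicator_of_mem hy]

omit [MeasurableSpace E] in
lemma continuous_topOnBallApprox {V : E → E → ℝ≥0∞} (hc : ∀ y, Continuous fun x => V x y) (k : ℕ)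
    (y : E) : Continuous fun x => topOnBallApprox V k x y := by
  by_cases hy : y ∈ Metric.closedBall (0 : E) k
  · simp only [topOnBallApprox, Set.indicator_of_mem hy]
    refine (hc y).add (continuous_const.min ?_)
    exact (ENNReal.continuous_const_mul (by simp)).comp
      (ENNReal.continuous_ofReal.comp (by fun_prop))
  · simp only [topOnBallApprox, Set.indicator_of_notMem hy]
    exact continuous_const

omit [MeasurableSpace E] in
lemma topOnBallApprox_le {V : E → E → ℝ≥0∞} {C : ℝ≥0∞} (hV : ∀ x y, V x y ≤ C) (k : ℕ) (x y : E) :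
    topOnBallApprox V k x y ≤ (Metric.closedBall (0 : E) k).indicator (fun _ => C + k) y :=
  Set.indicator_le_indicator (add_le_add (hV x y) (min_le_left _ _))

variable [BorelSpace E] [SecondCountableTopology E]

omit [SecondCountableTopology E] in
lemma measurable_topOnBallApprox {V : E → E → ℝ≥0∞} (hV : Measurable (Function.uncurry V)) (k : ℕ) :
    Measurable (Function.uncurry (topOnBallApprox V k)) := by
  have h : Function.uncurry (topOnBallApprox V k) =
      (Set.univ ×ˢ Metric.closedBall (0 : E) k).indicator (fun z => Function.uncurry V z +
        min (k : ℝ≥0∞) (k * ENNReal.ofReal (‖z.1‖ - ‖z.2‖))) := by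
    ext ⟨x, y⟩
    by_cases hy : y ∈ Metric.closedBall (0 : E) k
    · rw [Set.indicator_of_mem (by simpa using hy)]
      simp [topOnBallApprox, Set.indicator_of_mem hy]
    · rw [Set.indicator_of_notMem (by simpa using hy)]
      simp [topOnBallApprox, Set.indicator_of_notMem hy]
  rw [h]
  refine Measurable.indicator ?_ (MeasurableSet.univ.prod measurableSet_closedBall)
  fun_prop

omit [SecondCountableTopology E] in
lemma measurable_topOnBall {V : E → E → ℝ≥0∞} (hV : Measurable (Function.uncurry V)) :
    Measurable (Function.uncurry (topOnBall V)) :=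
  measurable_of_tendsto_metrizable (fun k => measurable_topOnBallApprox hV k)
    (tendsto_pi_nhds.2 fun z => tendsto_topOnBallApprox V z.1 z.2)

variable {x : ℕ → Ω → E} {ν : Measure E} {P : Measure Ω}

variable [SigmaFinite ν] [IsProbabilityMeasure P]

/-- `topOnBall V` is infinite on a ball and jumps in its first variable, so the Mecke formula for
continuous costs is applied to its increasing approximations and both sides pass to the limit. -/
lemma IsPoissonProcess.setLIntegral_expNeg_topOnBall (h : IsPoissonProcess (counting x) ν P)
    (hx : ∀ i, Measurable (x i)) (hν : ∀ r : ℝ, ν (Metric.closedBall 0 r) ≠ ∞)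
    {V : E → E → ℝ≥0∞} (hV : Measurable (Function.uncurry V)) (hc : ∀ y, Continuous fun x => V x y)
    {C : ℝ≥0∞} (hC : C ≠ ∞) (hVC : ∀ x y, V x y ≤ C)
    {A : Set E} (hA : MeasurableSet A) (hνA : ν A ≠ ∞) :
    ∫⁻ ω, ∫⁻ a in A, expNeg (∫⁻ y, topOnBall V a y ∂counting x ω) ∂counting x ω ∂P =
      ∫⁻ a in A, expNeg (V a a) * expNeg (∫⁻ y, (1 - expNeg (topOnBall V a y)) ∂ν) ∂ν := by
  have hΦ := measurable_counting hx
  have hm := measurable_topOnBallApprox hV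
  have hm' : ∀ k a, Measurable (topOnBallApprox V k a) := fun k a =>
    (hm k).comp measurable_prodMk_left
  have hstep := fun k : ℕ => h.lintegral_setLIntegral_expNeg_of_continuous hΦ hA hνA
    measurableSet_closedBall (hν k) (hm k) (continuous_topOnBallApprox hc k)
    (ENNReal.add_ne_top.2 ⟨hC, ENNReal.natCast_ne_top k⟩) (topOnBallApprox_le hVC k)
  have hlim : ∀ (μ : Measure E) a, Tendsto (fun k => ∫⁻ y, topOnBallApprox V k a y ∂μ) atTop
      (𝓝 (∫⁻ y, topOnBall V a y ∂μ)) := fun μ a =>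
    lintegral_tendsto_of_tendsto_of_monotone (fun k => (hm' k a).aemeasurable)
      (ae_of_all _ fun y => topOnBallApprox_mono V a y)
      (ae_of_all _ fun y => tendsto_topOnBallApprox V a y)
  have hL : Tendsto (fun k => ∫⁻ ω, ∫⁻ a in A, expNeg (∫⁻ y, topOnBallApprox V k a y ∂counting x ω)
      ∂counting x ω ∂P) atTop (𝓝 (∫⁻ ω, ∫⁻ a in A, expNeg (∫⁻ y, topOnBall V a y ∂counting x ω)
      ∂counting x ω ∂P)) := by
    refine tendsto_lintegral_of_dominated_convergence (fun ω => counting x ω A)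
      (fun k => measurable_lintegral_counting_expNeg hx hA (hm k))
      (fun n => ae_of_all _ fun ω => ?_) (h.lintegral_count_ne_top hA hνA) ?_
    · exact (lintegral_mono fun y => expNeg_le_one _).trans (by simp)
    · filter_upwards [h.ae_count_ne_top hΦ hA hνA] with ω hω
      exact tendsto_lintegral_of_dominated_convergence (fun _ => 1)
        (fun k => measurable_expNeg_lintegral_counting _ (hm k) ω)
        (fun n => ae_of_all _ fun x => expNeg_le_one _) (by simpa using hω)
        (ae_of_all _ fun a => (continuous_expNeg.tendsto _).comp (hlim _ a))
  refine tendsto_nhds_unique hL ?_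
  simp_rw [hstep]
  refine tendsto_lintegral_of_dominated_convergence (fun _ => 1) (fun k => ?_)
    (fun n => ae_of_all _ fun x => mul_le_one' (expNeg_le_one _) (expNeg_le_one _))
    (by simpa using hνA) (ae_of_all _ fun a => ?_)
  · refine (measurable_expNeg.comp ((hm k).comp (measurable_id.prodMk measurable_id))).mul
      (measurable_expNeg.comp (Measurable.lintegral_prod_right' (f := fun z : E × E =>
        1 - expNeg (topOnBallApprox V k z.1 z.2)) ?_))
    exact measurable_const.sub (measurable_expNeg.comp (hm k))
  · refine ENNReal.Tendsto.mul ((continuous_expNeg.tendsto _).comp ?_)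
      (Or.inr (expNeg_ne_top _)) ((continuous_expNeg.tendsto _).comp ?_)
      (Or.inr (expNeg_ne_top _))
    -- No point is strictly closer to the origin than itself, so the diagonal keeps only `V a a`.
    · simpa [topOnBall] using tendsto_topOnBallApprox V a a
    · refine lintegral_tendsto_of_tendsto_of_monotone
        (fun k => (measurable_const.sub (measurable_expNeg.comp (hm' k a))).aemeasurable)
        (ae_of_all _ fun y k l hkl =>
          tsub_le_tsub_left (expNeg_antitone (topOnBallApprox_mono V a y hkl)) _)
        (ae_of_all _ fun y => ?_)
      exact ENNReal.Tendsto.sub tendsto_const_nhds ((continuous_expNeg.tendsto _).comp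
        (tendsto_topOnBallApprox V a y)) (Or.inl ENNReal.one_ne_top)

lemma IsPoissonProcess.lintegral_tsum_expNeg_topOnBall (h : IsPoissonProcess (counting x) ν P)
    (hx : ∀ i, Measurable (x i)) (hν : ∀ r : ℝ, ν (Metric.closedBall 0 r) ≠ ∞)
    {V : E → E → ℝ≥0∞} (hV : Measurable (Function.uncurry V)) (hc : ∀ y, Continuous fun x => V x y)
    {C : ℝ≥0∞} (hC : C ≠ ∞) (hVC : ∀ x y, V x y ≤ C) :
    ∫⁻ ω, ∑' i, expNeg (∑' j, topOnBall V (x i ω) (x j ω)) ∂P =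
      ∫⁻ a, expNeg (V a a) * expNeg (∫⁻ y, (1 - expNeg (topOnBall V a y)) ∂ν) ∂ν := by
  have hm := measurable_topOnBall hV
  have hm' : ∀ a, Measurable (topOnBall V a) := fun a => hm.comp measurable_prodMk_left
  have hlim : ∀ (μ : Measure E) (F : E → ℝ≥0∞), Measurable F →
      Tendsto (fun n : ℕ => ∫⁻ a in Metric.closedBall 0 n, F a ∂μ) atTop (𝓝 (∫⁻ a, F a ∂μ)) := by
    intro μ F hF
    simp_rw [← lintegral_indicator (measurableSet_closedBall (x := (0 : E)))]
    refine lintegral_tendsto_of_tendsto_of_monotone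
      (fun n => (hF.indicator measurableSet_closedBall).aemeasurable)
      (ae_of_all _ fun y k l hkl => Set.indicator_le_indicator_of_subset
        (Metric.closedBall_subset_closedBall (by exact_mod_cast hkl)) (fun _ => zero_le) y)
      (ae_of_all _ fun y => tendsto_const_nhds.congr' ?_)
    obtain ⟨n, hn⟩ := exists_nat_ge ‖y‖
    filter_upwards [eventually_ge_atTop n] with k hk
    rw [Set.indicator_of_mem]
    rw [mem_closedBall_zero_iff]
    exact hn.trans (by exact_mod_cast hk)
  have hL : Tendsto (fun n : ℕ => ∫⁻ ω, ∫⁻ a in Metric.closedBall 0 n,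
      expNeg (∫⁻ y, topOnBall V a y ∂counting x ω) ∂counting x ω ∂P) atTop
      (𝓝 (∫⁻ ω, ∫⁻ a, expNeg (∫⁻ y, topOnBall V a y ∂counting x ω) ∂counting x ω ∂P)) :=
    lintegral_tendsto_of_tendsto_of_monotone
      (fun n => (measurable_lintegral_counting_expNeg hx measurableSet_closedBall hm).aemeasurable)
      (ae_of_all _ fun ω k l hkl => lintegral_mono_set
        (Metric.closedBall_subset_closedBall (by exact_mod_cast hkl)))
      (ae_of_all _ fun ω => hlim _ _ (measurable_expNeg_lintegral_counting _ hm ω))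
  have hR : Measurable fun a => expNeg (V a a) *
      expNeg (∫⁻ y, (1 - expNeg (topOnBall V a y)) ∂ν) := by
    refine (measurable_expNeg.comp (hV.comp (measurable_id.prodMk measurable_id))).mul
      (measurable_expNeg.comp (Measurable.lintegral_prod_right' (f := fun z : E × E =>
        1 - expNeg (topOnBall V z.1 z.2)) ?_))
    exact measurable_const.sub (measurable_expNeg.comp hm)
  have h1 : ∀ ω, ∑' i, expNeg (∑' j, topOnBall V (x i ω) (x j ω)) =
      ∫⁻ a, expNeg (∫⁻ y, topOnBall V a y ∂counting x ω) ∂counting x ω := fun ω => by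
    rw [lintegral_counting x ω (measurable_expNeg_lintegral_counting _ hm ω)]
    simp_rw [lintegral_counting x ω (hm' _)]
  simp_rw [h1]
  refine tendsto_nhds_unique hL ((hlim ν _ hR).congr fun n => ?_)
  exact (h.setLIntegral_expNeg_topOnBall hx hν hV hc hC hVC measurableSet_closedBall (hν n)).symm

omit [MeasurableSpace Ω] [MeasurableSpace E] [BorelSpace E] [SecondCountableTopology E] in
lemma tsum_topOnBall_of_forall_le {V : E → E → ℝ≥0∞} {ω : Ω} {i : ℕ}
    (hi : ∀ j, ‖x i ω‖ ≤ ‖x j ω‖) :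
    ∑' j, topOnBall V (x i ω) (x j ω) = ∑' j, V (x i ω) (x j ω) := by
  simp [topOnBall, not_lt.2 (hi _)]

omit [MeasurableSpace Ω] [MeasurableSpace E] [BorelSpace E] [SecondCountableTopology E] in
lemma expNeg_tsum_topOnBall_of_lt {V : E → E → ℝ≥0∞} {ω : Ω} {i j : ℕ}
    (hij : ‖x j ω‖ < ‖x i ω‖) : expNeg (∑' j, topOnBall V (x i ω) (x j ω)) = 0 := by
  rw [ENNReal.tsum_eq_top_of_eq_top ⟨j, by simp [topOnBall, hij]⟩, expNeg_top]

/-- Almost surely, the nearest point is unique. -/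
lemma IsPoissonProcess.ae_norm_lt (h : IsPoissonProcess (counting x) ν P)
    (hx : ∀ i, Measurable (x i)) (hν : ∀ r : ℝ, ν (Metric.closedBall 0 r) ≠ ∞)
    (hone : ∫⁻ a, expNeg (ν (Metric.ball 0 ‖a‖)) ∂ν = 1)
    (hnear : ∀ᵐ ω ∂P, ∀ i, ‖x 0 ω‖ ≤ ‖x i ω‖) :
    ∀ᵐ ω ∂P, ∀ i, i ≠ 0 → ‖x 0 ω‖ < ‖x i ω‖ := by
  -- With no other cost, each term of the series is the indicator that no point is strictly closer.
  -- By `hone` the expected number of such points is `1`.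
  set V : E → E → ℝ≥0∞ := fun _ _ => 0
  have hV : Measurable (Function.uncurry V) := measurable_const
  have hm := measurable_topOnBall hV
  have key := h.lintegral_tsum_expNeg_topOnBall hx hν hV (fun _ => continuous_const)
    ENNReal.zero_ne_top (fun _ _ => le_rfl)
  have h1 : ∀ a, ∫⁻ y, (1 - expNeg (topOnBall V a y)) ∂ν = ν (Metric.ball 0 ‖a‖) := fun a => by
    rw [← lintegral_indicator_one measurableSet_ball]
    congr 1 with y
    by_cases hy : ‖y‖ < ‖a‖
    · simp [topOnBall, hy, V]
    · simp [topOnBall, hy, V]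
  simp only [h1, V, expNeg_zero, one_mul, hone] at key
  have hg : ∀ i, Measurable fun ω => expNeg (∑' j, topOnBall V (x i ω) (x j ω)) := fun i =>
    measurable_expNeg.comp (Measurable.tsum fun j => hm.comp ((hx i).prodMk (hx j)))
  have hle : ∀ᵐ ω ∂P, expNeg (∑' j, topOnBall V (x 0 ω) (x j ω)) = 1 := by
    filter_upwards [hnear] with ω hω
    rw [tsum_topOnBall_of_forall_le hω]
    simp [V]
  -- The term of index `0` is already `1` and the whole series has mean `1`, so it equals `1` almost
  -- surely; a tie with another index would make it at least `2`.
  have hsum : ∀ᵐ ω ∂P, 1 = ∑' i, expNeg (∑' j, topOnBall V (x i ω) (x j ω)) := by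
    refine ae_eq_of_ae_le_of_lintegral_le ?_ (by simp) (Measurable.tsum hg).aemeasurable ?_
    · filter_upwards [hle] with ω hω
      rw [← hω]
      exact ENNReal.le_tsum (f := fun i => expNeg (∑' j, topOnBall V (x i ω) (x j ω))) 0
    · rw [key]; simp
  filter_upwards [hle, hsum, hnear] with ω h0 hs hn i hi
  refine lt_of_le_of_ne (hn i) fun heq => ?_
  have h2 : expNeg (∑' j, topOnBall V (x i ω) (x j ω)) = 1 := by
    rw [tsum_topOnBall_of_forall_le fun j => heq ▸ hn j]
    simp [V]
  have h3 := ENNReal.sum_le_tsum (f := fun i => expNeg (∑' j, topOnBall V (x i ω) (x j ω))) {0, i}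
  rw [Finset.sum_pair hi.symm, h0, h2, ← hs] at h3
  norm_num at h3

/-- The Laplace functional of the process seen from its nearest point. -/
theorem IsPoissonProcess.lintegral_expNeg_tsum_nearest (h : IsPoissonProcess (counting x) ν P)
    (hx : ∀ i, Measurable (x i)) (hν : ∀ r : ℝ, ν (Metric.closedBall 0 r) ≠ ∞)
    (hlt : ∀ᵐ ω ∂P, ∀ i, i ≠ 0 → ‖x 0 ω‖ < ‖x i ω‖)
    {V : E → E → ℝ≥0∞} (hV : Measurable (Function.uncurry V)) (hc : ∀ y, Continuous fun x => V x y)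
    {C : ℝ≥0∞} (hC : C ≠ ∞) (hVC : ∀ x y, V x y ≤ C) :
    ∫⁻ ω, expNeg (∑' j, V (x 0 ω) (x j ω)) ∂P =
      ∫⁻ a, expNeg (V a a) * expNeg (∫⁻ y, (1 - expNeg (topOnBall V a y)) ∂ν) ∂ν := by
  rw [← h.lintegral_tsum_expNeg_topOnBall hx hν hV hc hC hVC]
  refine lintegral_congr_ae ?_
  filter_upwards [hlt] with ω hω
  -- Any index `i ≠ 0` sees the point `0` strictly inside its ball and contributes `e^{-∞} = 0`.
  rw [tsum_eq_single 0 fun i hi => expNeg_tsum_topOnBall_of_lt (hω i hi),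
    tsum_topOnBall_of_forall_le]
  intro j
  rcases eq_or_ne j 0 with rfl | hj
  · exact le_rfl
  · exact (hω j hj).le

end Nearest

/-! ### Timers and fading variables, given the locations -/

/-- The joint law is a product, so Tonelli applies. It is used to freeze the locations, or one
network, or one timer, while the rest is averaged. -/
lemma lintegral_comp_prodMk_of_indepFun {Ω α β : Type*} [MeasurableSpace Ω] [MeasurableSpace α]
    [MeasurableSpace β] {P : Measure Ω} [IsFiniteMeasure P] {X : Ω → α} {Y : Ω → β}
    (h : IndepFun X Y P) (hX : Measurable X) (hY : Measurable Y) {f : α × β → ℝ≥0∞}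
    (hf : Measurable f) :
    ∫⁻ ω, f (X ω, Y ω) ∂P = ∫⁻ ω, ∫⁻ ω', f (X ω, Y ω') ∂P ∂P := by
  have h1 := (indepFun_iff_map_prod_eq_prod_map_map hX.aemeasurable hY.aemeasurable).1 h
  rw [← lintegral_map hf (hX.prodMk hY), h1, lintegral_prod _ hf.aemeasurable,
    lintegral_map hf.lintegral_prod_right' hX]
  congr 1 with ω
  exact lintegral_map (f := fun y => f (X ω, y)) (hf.comp measurable_prodMk_left) hY

section Marks

variable {Ω κ : Type*} [MeasurableSpace Ω] {P : Measure Ω} {M : κ ⊕ κ → Ω → ℝ}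

/-- The index `Sum.inl v` carries the timer of `v` and `Sum.inr v` its fading variable. The pair of
a new transmitter is independent of all pairs over `F`, which drives the induction. -/
lemma lintegral_prod_marks (hM : ∀ i, Measurable (M i)) (h : iIndepFun M P)
    {f : κ → ℝ × ℝ → ℝ≥0∞} (hf : ∀ v, Measurable (f v)) (F : Finset κ) :
    ∫⁻ ω, ∏ v ∈ F, f v (M (Sum.inl v) ω, M (Sum.inr v) ω) ∂P =
      ∏ v ∈ F, ∫⁻ ω, f v (M (Sum.inl v) ω, M (Sum.inr v) ω) ∂P := by
  classical
  have := h.isProbabilityMeasure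
  induction F using Finset.induction_on with
  | empty => simp
  | insert a F ha ih =>
    have hd : Disjoint ({Sum.inl a, Sum.inr a} : Finset (κ ⊕ κ)) (F.disjSum F) := by
      rw [Finset.disjoint_left]
      intro i hi
      rw [Finset.mem_insert, Finset.mem_singleton] at hi
      rcases hi with rfl | rfl <;> simpa using ha
    have hind := h.indepFun_finset _ _ hd hM
    have hf1 : Measurable fun z : ↥({Sum.inl a, Sum.inr a} : Finset (κ ⊕ κ)) → ℝ =>
        f a (z ⟨Sum.inl a, by simp⟩, z ⟨Sum.inr a, by simp⟩) := by fun_prop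
    have hf2 : Measurable fun z : ↥(F.disjSum F) → ℝ =>
        ∏ v ∈ F.attach, f v (z ⟨Sum.inl v, by simp⟩, z ⟨Sum.inr v, by simp⟩) := by fun_prop
    have hp : ∀ ω, ∏ v ∈ F, f v (M (Sum.inl v) ω, M (Sum.inr v) ω) =
        ∏ v ∈ F.attach, f v (M (Sum.inl v) ω, M (Sum.inr v) ω) := fun ω =>
      (Finset.prod_attach F fun v => f v (M (Sum.inl v) ω, M (Sum.inr v) ω)).symm
    simp_rw [Finset.prod_insert ha]
    rw [← ih]
    simp_rw [hp]
    refine lintegral_mul_eq_lintegral_mul_lintegral_of_indepFun'' ?_ ?_ (hind.comp hf1 hf2)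
    · exact (hf1.comp (measurable_pi_lambda _ fun i => hM i)).aemeasurable
    · exact (hf2.comp (measurable_pi_lambda _ fun i => hM i)).aemeasurable

/-- The timer of `u` occurs in every factor and couples them; once it is frozen, the factors are
independent. -/
lemma lintegral_prod_marks_of_notMem (hM : ∀ i, Measurable (M i)) (h : iIndepFun M P)
    {f : κ → ℝ × ℝ × ℝ → ℝ≥0∞} (hf : ∀ v, Measurable (f v)) {u : κ} {F : Finset κ} (hu : u ∉ F) :
    ∫⁻ ω, ∏ v ∈ F, f v (M (Sum.inl u) ω, M (Sum.inl v) ω, M (Sum.inr v) ω) ∂P =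
      ∫⁻ ω, ∏ v ∈ F, ∫⁻ ω', f v (M (Sum.inl u) ω, M (Sum.inl v) ω', M (Sum.inr v) ω') ∂P ∂P := by
  classical
  have := h.isProbabilityMeasure
  have hd : Disjoint ({Sum.inl u} : Finset (κ ⊕ κ)) (F.disjSum F) := by simpa using hu
  have hφ : Measurable fun z : ↥({Sum.inl u} : Finset (κ ⊕ κ)) → ℝ => z ⟨Sum.inl u, by simp⟩ :=
    measurable_pi_apply _
  have hind := (h.indepFun_finset _ _ hd hM).comp hφ measurable_id
  have hf2 : Measurable fun z : ℝ × (↥(F.disjSum F) → ℝ) =>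
      ∏ v ∈ F.attach, f v (z.1, z.2 ⟨Sum.inl v, by simp⟩, z.2 ⟨Sum.inr v, by simp⟩) := by
    fun_prop
  have key := lintegral_comp_prodMk_of_indepFun hind (hM _)
    (measurable_pi_lambda _ fun i => hM i) hf2
  have hp : ∀ ω ω', ∏ v ∈ F, f v (M (Sum.inl u) ω, M (Sum.inl v) ω', M (Sum.inr v) ω') =
      ∏ v ∈ F.attach, f v (M (Sum.inl u) ω, M (Sum.inl v) ω', M (Sum.inr v) ω') := fun ω ω' =>
    (Finset.prod_attach F fun v =>
      f v (M (Sum.inl u) ω, M (Sum.inl v) ω', M (Sum.inr v) ω')).symm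
  have hq : ∀ ω, ∏ v ∈ F, ∫⁻ ω', f v (M (Sum.inl u) ω, M (Sum.inl v) ω', M (Sum.inr v) ω') ∂P =
      ∫⁻ ω', ∏ v ∈ F, f v (M (Sum.inl u) ω, M (Sum.inl v) ω', M (Sum.inr v) ω') ∂P := fun ω =>
    (lintegral_prod_marks hM h (f := fun v z => f v (M (Sum.inl u) ω, z)) (fun v =>
      (hf v).comp measurable_prodMk_left) F).symm
  simp_rw [hq, hp]
  exact key

lemma volume_cond_Icc_zero_one : volume[|Set.Icc (0 : ℝ) 1] = volume.restrict (Set.Icc 0 1) := by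
  simp [ProbabilityTheory.cond]

/-- The contribution `-log (1 - t q)` of a transmitter that blocks with probability `q` a
transmitter with timer `t` if its own timer is smaller. -/
noncomputable def blockCost (t q : ℝ) : ℝ≥0∞ := ENNReal.ofReal (-Real.log (1 - t * q))

@[fun_prop] lemma measurable_blockCost : Measurable (Function.uncurry blockCost) := by
  unfold blockCost Function.uncurry
  fun_prop

lemma mul_lt_one_of_lt_of_le {t q : ℝ} (ht : 0 ≤ t) (ht1 : t < 1) (hq1 : q ≤ 1) :
    t * q < 1 := by nlinarith

/-- The restriction `t < 1` matters: at `t * q = 1` the convention `Real.log 0 = 0` would give cost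
`0` instead of `∞`. -/
lemma expNeg_blockCost {t q : ℝ} (ht : 0 ≤ t) (ht1 : t < 1) (hq : 0 ≤ q) (hq1 : q ≤ 1) :
    expNeg (blockCost t q) = ENNReal.ofReal (1 - t * q) :=
  expNeg_ofReal_neg_log (by linarith [mul_lt_one_of_lt_of_le ht ht1 hq1])
    (by linarith [mul_nonneg ht hq])

-- Blocking requires the independent events `T < t` and `G ∈ B`, of probabilities `t` and `q`, hence
-- has probability `t * q`.
open Classical in
lemma lintegral_ite_timer_lt [IsProbabilityMeasure P] {T G : Ω → ℝ} (hT : Measurable T)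
    (hG : Measurable G) (hTG : IndepFun T G P)
    (hlaw : HasLaw T (volume[|Set.Icc (0 : ℝ) 1]) P) {B : Set ℝ} (hB : MeasurableSet B) {q : ℝ}
    (hq : 0 ≤ q) (hq1 : q ≤ 1) (hGB : P (G ⁻¹' B) = ENNReal.ofReal q) {t : ℝ} (ht : 0 ≤ t)
    (ht1 : t < 1) :
    ∫⁻ ω, (if T ω < t ∧ G ω ∈ B then 0 else 1) ∂P = expNeg (blockCost t q) := by
  have h1 : P (T ⁻¹' Set.Iio t) = ENNReal.ofReal t := by
    rw [← Measure.map_apply hT measurableSet_Iio, hlaw.map_eq, volume_cond_Icc_zero_one,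
      Measure.restrict_apply measurableSet_Iio]
    have : Set.Iio t ∩ Set.Icc 0 1 = Set.Ico 0 t := by
      ext s
      simp only [Set.mem_inter_iff, Set.mem_Iio, Set.mem_Icc, Set.mem_Ico]
      constructor
      · rintro ⟨a, b, c⟩; exact ⟨b, a⟩
      · rintro ⟨a, b⟩; exact ⟨b, a, by linarith⟩
    rw [this, Real.volume_Ico, sub_zero]
  have hm : MeasurableSet (T ⁻¹' Set.Iio t ∩ G ⁻¹' B) :=
    (hT measurableSet_Iio).inter (hG hB)
  have h2 : ∀ ω, (if T ω < t ∧ G ω ∈ B then (0 : ℝ≥0∞) else 1) =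
      (T ⁻¹' Set.Iio t ∩ G ⁻¹' B)ᶜ.indicator 1 ω := fun ω => by
    by_cases h : T ω < t ∧ G ω ∈ B
    · rw [if_pos h, Set.indicator_of_notMem (by simpa using h)]
    · rw [if_neg h, Set.indicator_of_mem (by simpa using h), Pi.one_apply]
  simp_rw [h2]
  rw [lintegral_indicator_one hm.compl, prob_compl_eq_one_sub hm,
    hTG.measure_inter_preimage_eq_mul _ _ measurableSet_Iio hB, h1, hGB,
    expNeg_blockCost ht ht1 hq hq1, ENNReal.ofReal_sub _ (mul_nonneg ht hq), ENNReal.ofReal_one,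
    ENNReal.ofReal_mul ht]

open Classical in
/-- The probability that none of the other transmitters blocks the transmitter `u`. -/
theorem measure_forall_not_blocked [Countable κ] (hM : ∀ i, Measurable (M i)) (h : iIndepFun M P)
    (hlaw : ∀ v, HasLaw (M (Sum.inl v)) (volume[|Set.Icc (0 : ℝ) 1]) P) (u : κ)
    {B : κ → Set ℝ} (hB : ∀ v, MeasurableSet (B v)) {q : κ → ℝ}
    (hq : ∀ v, 0 ≤ q v) (hq1 : ∀ v, q v ≤ 1)
    (hGB : ∀ v, P (M (Sum.inr v) ⁻¹' B v) = ENNReal.ofReal (q v)) :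
    P {ω | ∀ v, v ≠ u → M (Sum.inl v) ω < M (Sum.inl u) ω → M (Sum.inr v) ω ∉ B v} =
      ∫⁻ t in Set.Icc (0 : ℝ) 1, expNeg (∑' v, if v = u then 0 else blockCost t (q v)) := by
  have := h.isProbabilityMeasure
  set f : κ → ℝ × ℝ × ℝ → ℝ≥0∞ := fun v z => if z.2.1 < z.1 ∧ z.2.2 ∈ B v then 0 else 1
  have hf : ∀ v, Measurable (f v) := fun v =>
    have h1 : MeasurableSet {z : ℝ × ℝ × ℝ | z.2.1 < z.1} :=
      measurableSet_lt (by fun_prop) (by fun_prop)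
    have h2 : MeasurableSet {z : ℝ × ℝ × ℝ | z.2.2 ∈ B v} :=
      (show Measurable fun z : ℝ × ℝ × ℝ => z.2.2 by fun_prop) (hB v)
    Measurable.ite (h1.inter h2) measurable_const measurable_const
  -- Finitely many competitors first; both sides then converge along finite sets, dominated by `1`.
  have hfin : ∀ F : Finset κ,
      ∫⁻ ω, ∏ v ∈ F.erase u, f v (M (Sum.inl u) ω, M (Sum.inl v) ω, M (Sum.inr v) ω) ∂P =
      ∫⁻ t in Set.Icc (0 : ℝ) 1, expNeg (∑ v ∈ F, if v = u then 0 else blockCost t (q v)) := by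
    intro F
    rw [lintegral_prod_marks_of_notMem hM h hf (Finset.notMem_erase u F)]
    rw [← volume_cond_Icc_zero_one, ← (hlaw u).map_eq, lintegral_map _ (hM _)]
    · have hae : ∀ᵐ ω ∂P, 0 ≤ M (Sum.inl u) ω ∧ M (Sum.inl u) ω < 1 := by
        rw [(hlaw u).ae_iff (p := fun t => 0 ≤ t ∧ t < 1) (by fun_prop), volume_cond_Icc_zero_one]
        have h1 : ∀ᵐ t : ℝ, t ≠ 1 := by simp [ae_iff]
        filter_upwards [ae_restrict_mem measurableSet_Icc, ae_restrict_of_ae h1] with t ht ht1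
        exact ⟨ht.1, lt_of_le_of_ne ht.2 ht1⟩
      refine lintegral_congr_ae ?_
      filter_upwards [hae] with ω hω
      rw [expNeg_sum, ← Finset.prod_erase (a := u) F (by simp)]
      refine Finset.prod_congr rfl fun v hv => ?_
      rw [if_neg (Finset.ne_of_mem_erase hv)]
      exact lintegral_ite_timer_lt (hM _) (hM _) (h.indepFun (by simp)) (hlaw v) (hB v) (hq v)
        (hq1 v) (hGB v) hω.1 hω.2
    · refine measurable_expNeg.comp (Finset.measurable_sum _ fun v _ => ?_)
      split_ifs
      · exact measurable_const
      · exact measurable_blockCost.comp (measurable_id.prodMk measurable_const)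
  set S := {ω | ∀ v, v ≠ u → M (Sum.inl v) ω < M (Sum.inl u) ω → M (Sum.inr v) ω ∉ B v}
  have hS : MeasurableSet S := by
    have : S = ⋂ v, {ω | v ≠ u → M (Sum.inl v) ω < M (Sum.inl u) ω → M (Sum.inr v) ω ∉ B v} := by
      ext ω; simp [S]
    rw [this]
    refine MeasurableSet.iInter fun v => ?_
    by_cases hv : v = u
    · simp [hv]
    · have : {ω | v ≠ u → M (Sum.inl v) ω < M (Sum.inl u) ω → M (Sum.inr v) ω ∉ B v} =
          ({ω | M (Sum.inl v) ω < M (Sum.inl u) ω} ∩ M (Sum.inr v) ⁻¹' B v)ᶜ := by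
        ext ω; simp [hv]
      rw [this]
      exact ((measurableSet_lt (hM _) (hM _)).inter (hM _ (hB v))).compl
  have hL : Tendsto (fun F : Finset κ =>
      ∫⁻ ω, ∏ v ∈ F.erase u, f v (M (Sum.inl u) ω, M (Sum.inl v) ω, M (Sum.inr v) ω) ∂P) atTop
      (𝓝 (P S)) := by
    rw [← lintegral_indicator_one hS]
    refine tendsto_lintegral_filter_of_dominated_convergence (fun _ => 1)
      (Eventually.of_forall fun F => ?_) (Eventually.of_forall fun F => ae_of_all _ fun ω => ?_)
      (by simp) (ae_of_all _ fun ω => ?_)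
    · exact Finset.measurable_prod _ fun v _ => (hf v).comp
        ((hM _).prodMk ((hM _).prodMk (hM _)))
    · exact Finset.prod_le_one' fun v _ => by simp only [f]; split_ifs <;> simp
    · refine tendsto_const_nhds.congr' ?_
      by_cases hω : ω ∈ S
      · filter_upwards with F
        rw [Set.indicator_of_mem hω, Finset.prod_eq_one, Pi.one_apply]
        intro v hv
        exact if_neg fun h => hω v (Finset.ne_of_mem_erase hv) h.1 h.2
      · rw [Set.indicator_of_notMem hω]
        simp only [S, Set.mem_ofPred_eq, not_forall, not_not] at hω
        obtain ⟨v, hv, h1, h2⟩ := hω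
        filter_upwards [eventually_ge_atTop {v}] with F hF
        have hvF : v ∈ F.erase u := Finset.mem_erase.2 ⟨hv, hF (Finset.mem_singleton_self v)⟩
        have hz : f v (M (Sum.inl u) ω, M (Sum.inl v) ω, M (Sum.inr v) ω) = 0 := if_pos ⟨h1, h2⟩
        exact (Finset.prod_eq_zero hvF hz).symm
  refine tendsto_nhds_unique hL ?_
  simp_rw [hfin]
  refine tendsto_lintegral_filter_of_dominated_convergence (fun _ => 1)
    (Eventually.of_forall fun F => ?_)
    (Eventually.of_forall fun F => ae_of_all _ fun ω => expNeg_le_one _)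
    (by simp) (ae_of_all _ fun t => (continuous_expNeg.tendsto _).comp ENNReal.summable.hasSum)
  refine measurable_expNeg.comp (Finset.measurable_sum _ fun v _ => ?_)
  split_ifs
  · exact measurable_const
  · exact measurable_blockCost.comp (measurable_id.prodMk measurable_const)

end Marks

/-! ### The access probability of the tagged transmitter as an integral -/

namespace Params

variable (p : Params)

/-- The probability that the power received at distance `d` exceeds the threshold `c`, both
normalized by the transmit power. -/
noncomputable def sense (c d : ℝ) : ℝ := Real.exp (-p.mu * c * p.pathLoss d)

variable {p}

lemma continuous_pathLoss : Continuous p.pathLoss :=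
  continuous_const.mul (Real.continuous_rpow_const p.alpha_pos.le)

lemma pathLoss_nonneg {d : ℝ} (hd : 0 ≤ d) : 0 ≤ p.pathLoss d :=
  mul_nonneg (sq_nonneg _) (Real.rpow_nonneg hd _)

lemma pathLoss_pos {d : ℝ} (hd : 0 < d) : 0 < p.pathLoss d :=
  mul_pos (pow_pos (div_pos (mul_pos (by norm_num) Real.pi_pos) p.wavelength_pos) 2)
    (Real.rpow_pos_of_pos hd _)

@[simp] lemma pathLoss_zero : p.pathLoss 0 = 0 := by
  rw [pathLoss, Real.zero_rpow p.alpha_pos.ne', mul_zero]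

lemma continuous_sense (c : ℝ) : Continuous (p.sense c) :=
  Real.continuous_exp.comp (continuous_const.mul continuous_pathLoss)

lemma sense_nonneg (c d : ℝ) : 0 ≤ p.sense c d := (Real.exp_pos _).le

lemma sense_le_one {c d : ℝ} (hc : 0 < c) (hd : 0 ≤ d) : p.sense c d ≤ 1 := by
  rw [sense, Real.exp_le_one_iff]
  have := mul_nonneg (mul_nonneg p.mu_pos.le hc.le) (p.pathLoss_nonneg hd)
  linarith

@[simp] lemma sense_zero (c : ℝ) : p.sense c 0 = 1 := by simp [sense]

end Params

variable {p : Params}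

-- At `d = 0` the path loss vanishes and division by zero gives `0 ≤ c`, so there is no blocking,
-- whereas `p.sense c 0 = 1`. The case distinctions on zero distance below come from here; they
-- affect only null events.
open Classical in
lemma expMeasure_setOf_div_pathLoss_not_le {c d : ℝ} (hc : 0 < c) (hd : 0 ≤ d) :
    expMeasure p.mu {g | ¬ g / p.pathLoss d ≤ c} =
      ENNReal.ofReal (if d = 0 then 0 else p.sense c d) := by
  have := isProbabilityMeasure_expMeasure p.mu_pos
  split_ifs with h
  · simp [h, hc.le]
  · have hd' : 0 < p.pathLoss d := Params.pathLoss_pos (lt_of_le_of_ne hd (Ne.symm h))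
    have h1 : {g | ¬ g / p.pathLoss d ≤ c} = (Set.Iic (c * p.pathLoss d))ᶜ := by
      ext g
      simp [div_le_iff₀ hd']
    rw [h1, prob_compl_eq_one_sub measurableSet_Iic, ← ofReal_cdf,
      cdf_expMeasure_eq p.mu_pos, if_pos (mul_nonneg hc.le hd'.le), ← ENNReal.ofReal_one,
      ← ENNReal.ofReal_sub, Params.sense]
    · congr 1; rw [sub_sub_cancel]; congr 1; ring
    · rw [sub_nonneg, Real.exp_le_one_iff]
      have := mul_nonneg p.mu_pos.le (mul_nonneg hc.le hd'.le)
      linarith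

/-- This makes the exponent of the Laplace functional linear in `t`. -/
lemma one_sub_expNeg_blockCost {t q : ℝ} (ht : 0 ≤ t) (ht1 : t < 1) (hq : 0 ≤ q) (hq1 : q ≤ 1) :
    1 - expNeg (blockCost t q) = ENNReal.ofReal t * ENNReal.ofReal q := by
  rw [expNeg_blockCost ht ht1 hq hq1, ← ENNReal.ofReal_one,
    ← ENNReal.ofReal_sub _ (by linarith [mul_lt_one_of_lt_of_le ht ht1 hq1]), sub_sub_cancel,
    ENNReal.ofReal_mul ht]

section Tagged

variable {Ω : Type*} [MeasurableSpace Ω] {P : Measure Ω} [IsProbabilityMeasure P]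
  {x y : ℕ → Ω → Plane} {νx νy : Measure Plane} {c : ℝ}

/-- The mean number of transmitters farther from the origin than `a` whose power sensed at `a`
exceeds the threshold. -/
noncomputable def sensedBeyond (p : Params) (ν : Measure Plane) (c : ℝ) (a : Plane) : ℝ≥0∞ :=
  ∫⁻ b in (Metric.closedBall 0 ‖a‖)ᶜ, ENNReal.ofReal (p.sense c ‖b - a‖) ∂ν

/-- The contribution of a transmitter at `b` to the blocking of a transmitter at `a`. -/
noncomputable def sensingCost (p : Params) (c t : ℝ) (a b : Plane) : ℝ≥0∞ :=
  blockCost t (p.sense c ‖b - a‖)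

lemma continuous_sensingCost (hc : 0 < c) {t : ℝ} (ht : 0 ≤ t) (ht1 : t < 1) :
    Continuous (Function.uncurry (sensingCost p c t)) := by
  refine ENNReal.continuous_ofReal.comp (Continuous.neg (Continuous.log ?_ fun z => ?_))
  · exact continuous_const.sub (continuous_const.mul ((p.continuous_sense c).comp (by fun_prop)))
  · linarith [mul_lt_one_of_lt_of_le ht ht1 (p.sense_le_one hc (norm_nonneg (z.2 - z.1)))]

lemma sensingCost_le (hc : 0 < c) {t : ℝ} (ht : 0 ≤ t) (ht1 : t < 1) (a b : Plane) :
    sensingCost p c t a b ≤ ENNReal.ofReal (-Real.log (1 - t)) := by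
  refine ENNReal.ofReal_le_ofReal (neg_le_neg (Real.log_le_log (by linarith) ?_))
  nlinarith [p.sense_le_one hc (norm_nonneg (b - a))]

/-- The nearest-point formula includes the cost of the tagged point against itself, which is `-log
(1 - t)` as the sensing probability at distance `0` is `1`. It gives the factor `1 - t` on both
sides, nonzero as `t < 1`, and cancels. Inside the open ball the infinite cost yields the void
probability; null spheres allow passing to the closed ball. -/
lemma lintegral_expNeg_blockCost_nearest [SigmaFinite νx]
    (h : IsPoissonProcess (counting x) νx P)
    (hx : ∀ i, Measurable (x i)) (hν : ∀ r : ℝ, νx (Metric.closedBall 0 r) ≠ ∞)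
    (hsph : ∀ r : ℝ, νx (Metric.sphere 0 r) = 0)
    (hlt : ∀ᵐ ω ∂P, ∀ i, i ≠ 0 → ‖x 0 ω‖ < ‖x i ω‖) (hc : 0 < c) {t : ℝ} (ht : 0 ≤ t)
    (ht1 : t < 1) :
    ∫⁻ ω, expNeg (∑' j, if j = 0 then 0 else blockCost t (p.sense c ‖x j ω - x 0 ω‖)) ∂P =
      ∫⁻ a, expNeg (νx (Metric.ball 0 ‖a‖) + ENNReal.ofReal t * sensedBeyond p νx c a) ∂νx := by
  set V := sensingCost p c t
  have hs0 : ∀ a b : Plane, 0 ≤ p.sense c ‖b - a‖ := fun a b => Params.sense_nonneg _ _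
  have hs1 : ∀ a b : Plane, p.sense c ‖b - a‖ ≤ 1 := fun a b =>
    Params.sense_le_one hc (norm_nonneg _)
  have hcont := continuous_sensingCost (p := p) hc ht ht1
  have hcV : ∀ b, Continuous fun a => V a b := fun b => hcont.uncurry_right b
  have key := h.lintegral_expNeg_tsum_nearest hx hν hlt (V := V) hcont.measurable hcV
    ENNReal.ofReal_ne_top (sensingCost_le hc ht ht1)
  have hVaa : ∀ a, expNeg (V a a) = ENNReal.ofReal (1 - t) := fun a => by
    simp only [V, sensingCost, sub_self, norm_zero, Params.sense_zero]
    rw [expNeg_blockCost ht ht1 zero_le_one le_rfl, mul_one]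
  have h1 : ∀ ω, expNeg (∑' j, V (x 0 ω) (x j ω)) = ENNReal.ofReal (1 - t) *
      expNeg (∑' j, if j = 0 then 0 else blockCost t (p.sense c ‖x j ω - x 0 ω‖)) := fun ω => by
    have h3 : ∑' j, V (x 0 ω) (x j ω) = V (x 0 ω) (x 0 ω) +
        ∑' j, if j = 0 then 0 else V (x 0 ω) (x j ω) := ENNReal.summable.tsum_eq_add_tsum_ite' 0
    rw [h3, expNeg_add, hVaa]
    rfl
  have h2 : ∀ a, ∫⁻ b, (1 - expNeg (topOnBall V a b)) ∂νx =
      νx (Metric.ball 0 ‖a‖) + ENNReal.ofReal t * sensedBeyond p νx c a := fun a => by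
    have hms : Measurable fun b : Plane => ENNReal.ofReal (p.sense c ‖b - a‖) :=
      ENNReal.measurable_ofReal.comp ((p.continuous_sense c).measurable.comp (by fun_prop))
    rw [← lintegral_add_compl _ (measurableSet_ball (x := (0 : Plane)) (ε := ‖a‖))]
    congr 1
    · rw [← setLIntegral_one]
      refine setLIntegral_congr_fun measurableSet_ball fun b hb => ?_
      rw [mem_ball_zero_iff] at hb
      simp [topOnBall, hb]
    · have hae : ((Metric.ball (0 : Plane) ‖a‖)ᶜ : Set Plane) =ᵐ[νx]
          ((Metric.closedBall (0 : Plane) ‖a‖)ᶜ : Set Plane) := by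
        refine Filter.EventuallyEq.compl ?_
        rw [← Metric.ball_union_sphere]
        exact (union_ae_eq_left_of_ae_eq_empty (ae_eq_empty.2 (hsph _))).symm
      rw [sensedBeyond, ← setLIntegral_congr hae, ← lintegral_const_mul _ hms]
      refine setLIntegral_congr_fun measurableSet_ball.compl fun b hb => ?_
      rw [Set.mem_compl_iff, mem_ball_zero_iff] at hb
      simp only [topOnBall, hb, if_false, add_zero]
      exact one_sub_expNeg_blockCost ht ht1 (hs0 a b) (hs1 a b)
  simp_rw [h1, h2, hVaa] at key
  rw [lintegral_const_mul' _ _ ENNReal.ofReal_ne_top,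
    lintegral_const_mul' _ _ ENNReal.ofReal_ne_top] at key
  exact (ENNReal.mul_right_inj (by simpa using ht1) ENNReal.ofReal_ne_top).1 key

/-- Translation invariance of the intensity removes the dependence on the observer `a`, and
coincidence with `a` is negligible. -/
lemma lintegral_expNeg_blockCost [SigmaFinite νy]
    (h : IsPoissonProcess (counting y) νy P) (hy : ∀ i, Measurable (y i)) [νy.IsAddRightInvariant]
    (hpt : ∀ a, νy {a} = 0) (hc : 0 < c) {t : ℝ} (ht : 0 ≤ t) (ht1 : t < 1) (a : Plane) :
    ∫⁻ ω, expNeg (∑' m, blockCost t (if ‖y m ω - a‖ = 0 then 0 else p.sense c ‖y m ω - a‖)) ∂P =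
      expNeg (ENNReal.ofReal t * ∫⁻ b, ENNReal.ofReal (p.sense c ‖b‖) ∂νy) := by
  have hm : Measurable fun b : Plane => if ‖b - a‖ = 0 then 0 else p.sense c ‖b - a‖ :=
    Measurable.ite (measurableSet_eq_fun (by fun_prop) measurable_const) measurable_const
      ((p.continuous_sense c).measurable.comp (by fun_prop))
  have hm' : Measurable fun b : Plane =>
      blockCost t (if ‖b - a‖ = 0 then 0 else p.sense c ‖b - a‖) :=
    measurable_blockCost.comp (measurable_const.prodMk hm)
  have key := h.lintegral_expNeg_lintegral (measurable_counting hy) hm'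
  simp_rw [lintegral_counting y _ hm'] at key
  rw [key]
  congr 1
  have hms : Measurable fun b : Plane => ENNReal.ofReal (p.sense c ‖b‖) :=
    ENNReal.measurable_ofReal.comp ((p.continuous_sense c).measurable.comp (by fun_prop))
  rw [← lintegral_const_mul _ hms,
    ← lintegral_sub_right_eq_self (fun b => ENNReal.ofReal t * ENNReal.ofReal (p.sense c ‖b‖)) a]
  have hne : ∀ᵐ b ∂νy, b ≠ a := by simpa [ae_iff] using hpt a
  refine lintegral_congr_ae ?_
  filter_upwards [hne] with b hb
  have : ‖b - a‖ ≠ 0 := by simpa [sub_eq_zero] using hb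
  rw [if_neg this, one_sub_expNeg_blockCost ht ht1 (Params.sense_nonneg _ _)
    (Params.sense_le_one hc (norm_nonneg _))]

end Tagged

section Access

variable {Ω : Type*} [MeasurableSpace Ω] {P : Measure Ω} [IsProbabilityMeasure P]
  {x y : ℕ → Ω → Plane} {νx νy : Measure Plane} {c d : ℝ}

lemma tsum_node (f : Node → ℝ≥0∞) :
    ∑' v, f v = ∑' j, f (Sum.inl j) + ∑' m, f (Sum.inr m) :=
  ENNReal.summable.tsum_sum ENNReal.summable

/-- Given the first process, the mean contribution of the second does not depend on where the tagged
point lies, so it comes out as a constant factor. -/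
lemma lintegral_expNeg_add_blockCost [SigmaFinite νx] [SigmaFinite νy] [νy.IsAddRightInvariant]
    (hPx : IsPoissonProcess (counting x) νx P) (hPy : IsPoissonProcess (counting y) νy P)
    (hx : ∀ i, Measurable (x i)) (hy : ∀ i, Measurable (y i))
    (hxy : IndepFun (fun ω i => x i ω) (fun ω k => y k ω) P)
    (hν : ∀ r : ℝ, νx (Metric.closedBall 0 r) ≠ ∞) (hsph : ∀ r : ℝ, νx (Metric.sphere 0 r) = 0)
    (hpt : ∀ a, νy {a} = 0) (hlt : ∀ᵐ ω ∂P, ∀ i, i ≠ 0 → ‖x 0 ω‖ < ‖x i ω‖)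
    (hc : 0 < c) (hd : 0 < d) {t : ℝ} (ht : 0 ≤ t) (ht1 : t < 1) :
    ∫⁻ ω, expNeg ((∑' j, if j = 0 then 0 else
        blockCost t (if ‖x j ω - x 0 ω‖ = 0 then 0 else p.sense c ‖x j ω - x 0 ω‖)) +
      ∑' m, blockCost t (if ‖y m ω - x 0 ω‖ = 0 then 0 else p.sense d ‖y m ω - x 0 ω‖)) ∂P =
      expNeg (ENNReal.ofReal t * ∫⁻ b, ENNReal.ofReal (p.sense d ‖b‖) ∂νy) *
      ∫⁻ a, expNeg (νx (Metric.ball 0 ‖a‖) + ENNReal.ofReal t * sensedBeyond p νx c a) ∂νx := by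
  have hmc : ∀ c' : ℝ, Measurable fun b : Plane =>
      blockCost t (if ‖b‖ = 0 then 0 else p.sense c' ‖b‖) := fun c' =>
    measurable_blockCost.comp (measurable_const.prodMk (Measurable.ite
      (measurableSet_eq_fun (by fun_prop) measurable_const) measurable_const
      ((p.continuous_sense c').measurable.comp (by fun_prop))))
  have hfx : Measurable fun z : ℕ → Plane => ∑' j, if j = 0 then 0 else
      blockCost t (if ‖z j - z 0‖ = 0 then 0 else p.sense c ‖z j - z 0‖) := by
    refine Measurable.tsum fun j => ?_
    split_ifs
    · exact measurable_const
    · exact (hmc c).comp (f := fun z : ℕ → Plane => z j - z 0) (by fun_prop)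
  have hfy : Measurable fun z : (ℕ → Plane) × (ℕ → Plane) =>
      ∑' m, blockCost t (if ‖z.2 m - z.1 0‖ = 0 then 0 else p.sense d ‖z.2 m - z.1 0‖) :=
    Measurable.tsum fun m => (hmc d).comp
      (f := fun z : (ℕ → Plane) × (ℕ → Plane) => z.2 m - z.1 0) (by fun_prop)
  have key := lintegral_comp_prodMk_of_indepFun hxy (measurable_pi_lambda _ hx)
    (measurable_pi_lambda _ hy) (f := fun z => expNeg ((∑' j, if j = 0 then 0 else
        blockCost t (if ‖z.1 j - z.1 0‖ = 0 then 0 else p.sense c ‖z.1 j - z.1 0‖)) +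
      ∑' m, blockCost t (if ‖z.2 m - z.1 0‖ = 0 then 0 else p.sense d ‖z.2 m - z.1 0‖)))
    (measurable_expNeg.comp ((hfx.comp measurable_fst).add hfy))
  rw [key]
  simp_rw [expNeg_add]
  have h1 : ∀ ω, ∫⁻ ω', expNeg (∑' j, if j = 0 then 0 else
        blockCost t (if ‖x j ω - x 0 ω‖ = 0 then 0 else p.sense c ‖x j ω - x 0 ω‖)) *
      expNeg (∑' m, blockCost t (if ‖y m ω' - x 0 ω‖ = 0 then 0 else
        p.sense d ‖y m ω' - x 0 ω‖)) ∂P =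
      expNeg (ENNReal.ofReal t * ∫⁻ b, ENNReal.ofReal (p.sense d ‖b‖) ∂νy) *
      expNeg (∑' j, if j = 0 then 0 else
        blockCost t (if ‖x j ω - x 0 ω‖ = 0 then 0 else p.sense c ‖x j ω - x 0 ω‖)) := fun ω => by
    rw [lintegral_const_mul' _ _ (expNeg_ne_top _), lintegral_expNeg_blockCost hPy hy hpt hd ht ht1,
      mul_comm]
  simp_rw [h1]
  rw [lintegral_const_mul' _ _ (expNeg_ne_top _)]
  congr 1
  have h2 := lintegral_expNeg_blockCost_nearest (p := p) hPx hx hν hsph hlt hc ht ht1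
  simp_rw [expNeg_add] at h2
  rw [← h2]
  refine lintegral_congr_ae ?_
  -- No other point coincides with the strictly nearest one, so the zero-distance case never occurs.
  filter_upwards [hlt] with ω hω
  congr 2 with j
  split_ifs with h3 h4
  · rfl
  · have h5 := hω j h3
    rw [sub_eq_zero.1 (norm_eq_zero.1 h4)] at h5
    exact absurd h5 (lt_irrefl _)
  · rfl

/-- The probability that the transmitter nearest to the origin accesses the medium. -/
theorem measure_nearest_not_blocked [SigmaFinite νx] [SigmaFinite νy] [νy.IsAddRightInvariant]
    (hPx : IsPoissonProcess (counting x) νx P) (hPy : IsPoissonProcess (counting y) νy P)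
    (hx : ∀ i, Measurable (x i)) (hy : ∀ i, Measurable (y i))
    (hxy : IndepFun (fun ω i => x i ω) (fun ω k => y k ω) P)
    (hν : ∀ r : ℝ, νx (Metric.closedBall 0 r) ≠ ∞) (hsph : ∀ r : ℝ, νx (Metric.sphere 0 r) = 0)
    (hpt : ∀ a, νy {a} = 0) (hlt : ∀ᵐ ω ∂P, ∀ i, i ≠ 0 → ‖x 0 ω‖ < ‖x i ω‖)
    (hc : 0 < c) (hd : 0 < d) {M : Node ⊕ Node → Ω → ℝ}
    (hM : ∀ i, Measurable (M i)) (hind : iIndepFun M P)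
    (htimer : ∀ v, HasLaw (M (Sum.inl v)) (volume[|Set.Icc (0 : ℝ) 1]) P)
    (hfading : ∀ v, HasLaw (M (Sum.inr v)) (expMeasure p.mu) P)
    (hloc : IndepFun (fun ω => ((fun i => x i ω : ℕ → Plane), (fun k => y k ω : ℕ → Plane)))
      (fun ω i => M i ω) P) :
    P {ω | (∀ j, j ≠ 0 → M (Sum.inl (Sum.inl j)) ω < M (Sum.inl (Sum.inl 0)) ω →
          M (Sum.inr (Sum.inl j)) ω / p.pathLoss ‖x j ω - x 0 ω‖ ≤ c) ∧
        ∀ m, M (Sum.inl (Sum.inr m)) ω < M (Sum.inl (Sum.inl 0)) ω →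
          M (Sum.inr (Sum.inr m)) ω / p.pathLoss ‖y m ω - x 0 ω‖ ≤ d} =
      ∫⁻ t in Set.Icc (0 : ℝ) 1,
        expNeg (ENNReal.ofReal t * ∫⁻ b, ENNReal.ofReal (p.sense d ‖b‖) ∂νy) *
        ∫⁻ a, expNeg (νx (Metric.ball 0 ‖a‖) + ENNReal.ofReal t * sensedBeyond p νx c a) ∂νx := by
  set pos : (ℕ → Plane) × (ℕ → Plane) → Node → Plane := fun z => Sum.elim z.1 z.2 with hpos
  set thr : Node → ℝ := Sum.elim (fun _ => c) (fun _ => d) with hthr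
  have hthr0 : ∀ v, 0 < thr v := by rintro (j | m) <;> simp [hthr, hc, hd]
  have hposm : ∀ v, Measurable fun z => pos z v := by
    rintro (j | m) <;> simp only [hpos, Sum.elim_inl, Sum.elim_inr] <;> fun_prop
  set S : Set (((ℕ → Plane) × (ℕ → Plane)) × (Node ⊕ Node → ℝ)) :=
    {z | ∀ v : Node, v ≠ Sum.inl 0 → z.2 (Sum.inl v) < z.2 (Sum.inl (Sum.inl 0)) →
      z.2 (Sum.inr v) / p.pathLoss ‖pos z.1 v - z.1.1 0‖ ≤ thr v} with hSdef
  have hS : MeasurableSet S := by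
    have h1 : S = ⋂ v : Node, {z | v ≠ Sum.inl 0 → z.2 (Sum.inl v) < z.2 (Sum.inl (Sum.inl 0)) →
        z.2 (Sum.inr v) / p.pathLoss ‖pos z.1 v - z.1.1 0‖ ≤ thr v} := by
      ext z; simp [S]
    rw [h1]
    refine MeasurableSet.iInter fun v => ?_
    have hdm : Measurable fun z : ((ℕ → Plane) × (ℕ → Plane)) × (Node ⊕ Node → ℝ) =>
        p.pathLoss ‖pos z.1 v - z.1.1 0‖ :=
      p.continuous_pathLoss.measurable.comp
        (((hposm v).comp measurable_fst).sub (by fun_prop)).norm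
    have h2 : Measurable fun z : ((ℕ → Plane) × (ℕ → Plane)) × (Node ⊕ Node → ℝ) =>
        z.2 (Sum.inr v) / p.pathLoss ‖pos z.1 v - z.1.1 0‖ :=
      Measurable.div (by fun_prop) hdm
    have h3 : MeasurableSet {z : ((ℕ → Plane) × (ℕ → Plane)) × (Node ⊕ Node → ℝ) |
        z.2 (Sum.inl v) < z.2 (Sum.inl (Sum.inl 0))} :=
      measurableSet_lt (by fun_prop) (by fun_prop)
    exact MeasurableSet.imp (MeasurableSet.const _) (h3.imp (measurableSet_le h2 measurable_const))
  have hMm : Measurable fun ω i => M i ω := measurable_pi_lambda _ hM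
  have hlocm : Measurable fun ω => ((fun i => x i ω : ℕ → Plane), (fun k => y k ω : ℕ → Plane)) :=
    (measurable_pi_lambda _ hx).prodMk (measurable_pi_lambda _ hy)
  have hset : {ω | (∀ j, j ≠ 0 → M (Sum.inl (Sum.inl j)) ω < M (Sum.inl (Sum.inl 0)) ω →
          M (Sum.inr (Sum.inl j)) ω / p.pathLoss ‖x j ω - x 0 ω‖ ≤ c) ∧
        ∀ m, M (Sum.inl (Sum.inr m)) ω < M (Sum.inl (Sum.inl 0)) ω →
          M (Sum.inr (Sum.inr m)) ω / p.pathLoss ‖y m ω - x 0 ω‖ ≤ d} =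
      (fun ω => (((fun i => x i ω : ℕ → Plane), (fun k => y k ω : ℕ → Plane)), fun i => M i ω)) ⁻¹'
        S := by
    ext ω
    simp [S, Sum.forall, hpos, hthr]
  have key := lintegral_comp_prodMk_of_indepFun hloc hlocm hMm
    (f := S.indicator 1) (measurable_one.indicator hS)
  set q : Node → Ω → ℝ := fun v ω => if ‖Sum.elim (fun i => x i ω) (fun k => y k ω) v - x 0 ω‖ = 0
    then 0 else p.sense (thr v) ‖Sum.elim (fun i => x i ω) (fun k => y k ω) v - x 0 ω‖ with hq
  have hqm : ∀ v, Measurable (q v) := fun v => by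
    have h1 : Measurable fun ω => ‖Sum.elim (fun i => x i ω) (fun k => y k ω) v - x 0 ω‖ :=
      (((hposm v).comp hlocm).sub (hx 0)).norm
    exact Measurable.ite (measurableSet_eq_fun h1 measurable_const) measurable_const
      ((p.continuous_sense _).measurable.comp h1)
  -- With the locations frozen, the result for marks applies with deterministic blocking
  -- probabilities.
  have hsec : ∀ ω, ∫⁻ ω', S.indicator 1 (((fun i => x i ω : ℕ → Plane),
      (fun k => y k ω : ℕ → Plane)), fun i => M i ω') ∂P =
      ∫⁻ t in Set.Icc (0 : ℝ) 1, expNeg (∑' v : Node, if v = Sum.inl 0 then 0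
        else blockCost t (q v ω)) := fun ω => by
    have hBm : ∀ v, MeasurableSet {g : ℝ | ¬ g /
        p.pathLoss ‖Sum.elim (fun i => x i ω) (fun k => y k ω) v - x 0 ω‖ ≤ thr v} := fun v =>
      (measurableSet_le (measurable_id.div_const _) measurable_const).compl
    have h1 := measure_forall_not_blocked hM hind htimer (Sum.inl 0) hBm (q := fun v => q v ω)
      (fun v => by simp only [hq]; split_ifs; exacts [le_rfl, Params.sense_nonneg _ _])
      (fun v => by
        simp only [hq]
        split_ifs
        exacts [zero_le_one, Params.sense_le_one (hthr0 v) (norm_nonneg _)])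
      (fun v => by
        rw [← Measure.map_apply (hM _) (hBm v), (hfading v).map_eq,
          expMeasure_setOf_div_pathLoss_not_le (hthr0 v) (norm_nonneg _)])
    have h2 : MeasurableSet ((fun ω' => (((fun i => x i ω : ℕ → Plane),
      (fun k => y k ω : ℕ → Plane)), fun i => M i ω')) ⁻¹' S) :=
      (measurable_const.prodMk hMm) hS
    have h3 : ∀ ω', S.indicator (1 : ((ℕ → Plane) × (ℕ → Plane)) × (Node ⊕ Node → ℝ) → ℝ≥0∞)
        (((fun i => x i ω : ℕ → Plane), (fun k => y k ω : ℕ → Plane)), fun i => M i ω') =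
        ((fun ω' => (((fun i => x i ω : ℕ → Plane), (fun k => y k ω : ℕ → Plane)),
          fun i => M i ω')) ⁻¹' S).indicator (1 : Ω → ℝ≥0∞) ω' := fun ω' => rfl
    simp_rw [h3]
    rw [lintegral_indicator_one h2]
    refine Eq.trans ?_ (h1.trans ?_)
    · congr 1
      ext ω'
      simp [S, hpos]
    · congr!
  rw [hset, ← lintegral_indicator_one ((hlocm.prodMk hMm) hS)]
  refine key.trans ?_
  simp_rw [hsec]
  rw [lintegral_lintegral_swap]
  · have hne : ∀ᵐ t : ℝ, t ≠ 1 := by simp [ae_iff]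
    refine lintegral_congr_ae ?_
    filter_upwards [ae_restrict_mem measurableSet_Icc, ae_restrict_of_ae hne] with t ht ht1
    rw [← lintegral_expNeg_add_blockCost hPx hPy hx hy hxy hν hsph hpt hlt hc hd ht.1
      (lt_of_le_of_ne ht.2 ht1)]
    refine lintegral_congr fun ω => ?_
    rw [tsum_node]
    simp only [hq, hthr, Sum.elim_inl, Sum.elim_inr, Sum.inl.injEq, reduceCtorEq, if_false]
    congr!
  · refine (measurable_expNeg.comp (Measurable.tsum fun v => ?_)).aemeasurable
    split_ifs
    · exact measurable_const
    · exact measurable_blockCost.comp (measurable_snd.prodMk ((hqm v).comp measurable_fst))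

end Access

/-! ### Evaluation of the integrals -/

/-- In polar coordinates the integrand is `r * exp(-K r^α)`, integrable since `α > 0`. -/
lemma integrable_sense {c : ℝ} (hc : 0 < c) : Integrable fun b : Plane => p.sense c ‖b‖ := by
  have hK : 0 < p.mu * c * (4 * Real.pi / p.wavelength) ^ 2 :=
    mul_pos (mul_pos p.mu_pos hc)
      (pow_pos (div_pos (mul_pos (by norm_num) Real.pi_pos) p.wavelength_pos) 2)
  rw [integrable_fun_norm_addHaar volume (f := p.sense c)]
  have h := integrableOn_rpow_mul_exp_neg_mul_rpow (s := 1) (by norm_num) p.alpha_pos hK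
  refine h.congr_fun (fun r _ => ?_) measurableSet_Ioi
  simp only [finrank_euclideanSpace_fin, smul_eq_mul, Params.sense, Params.pathLoss]
  norm_num
  left
  ring

lemma integrable_sense_sub {c : ℝ} (hc : 0 < c) (a : Plane) :
    Integrable fun b : Plane => p.sense c ‖b - a‖ :=
  (integrable_sense hc).comp_sub_right a

lemma lintegral_smul_sense {lam c : ℝ} (hlam : 0 < lam) (hc : 0 < c) (a : Plane) (A : Set Plane) :
    ∫⁻ b in A, ENNReal.ofReal (p.sense c ‖b - a‖) ∂(ENNReal.ofReal lam • volume) =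
      ENNReal.ofReal (lam * ∫ b in A, p.sense c ‖b - a‖) := by
  rw [Measure.restrict_smul, lintegral_smul_measure, smul_eq_mul, ENNReal.ofReal_mul hlam.le,
    ofReal_integral_eq_lintegral_ofReal (integrable_sense_sub hc a).integrableOn
      (ae_of_all _ fun b => Params.sense_nonneg _ _)]

/-- Two vectors of equal norm are exchanged by the reflection in the hyperplane orthogonal to their
difference. -/
lemma exists_linearIsometryEquiv_apply_eq (a : Plane) :
    ∃ f : Plane ≃ₗᵢ[ℝ] Plane, f a = !₂[‖a‖, 0] := by
  refine ⟨_, Submodule.reflection_sub (v := a) (w := !₂[‖a‖, 0]) ?_⟩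
  simp [EuclideanSpace.norm_eq]

lemma setIntegral_sense_eq (c : ℝ) (a : Plane) :
    ∫ b in (Metric.closedBall 0 ‖a‖)ᶜ, p.sense c ‖b - a‖ =
      ∫ b in (Metric.closedBall 0 ‖a‖)ᶜ, p.sense c ‖b - !₂[‖a‖, 0]‖ := by
  obtain ⟨f, hf⟩ := exists_linearIsometryEquiv_apply_eq a
  have h := f.measurePreserving.setIntegral_preimage_emb f.toHomeomorph.measurableEmbedding
    (fun b => p.sense c ‖b - !₂[‖a‖, 0]‖) (Metric.closedBall 0 ‖a‖)ᶜ
  rw [← h]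
  have hpre : f ⁻¹' (Metric.closedBall 0 ‖a‖)ᶜ = (Metric.closedBall 0 ‖a‖)ᶜ := by
    ext b; simp
  rw [hpre]
  simp_rw [← hf, ← map_sub, f.norm_map]

/-- The mean number of transmitters outside `B(0, r)` whose power sensed at `(r, 0)` exceeds the
threshold. -/
noncomputable def meanBeyond (p : Params) (lam c r : ℝ) : ℝ :=
  lam * ∫ b in (Metric.closedBall (0 : Plane) r)ᶜ, p.sense c ‖b - !₂[r, 0]‖

/-- The mean number of transmitters whose power sensed at the origin exceeds the threshold. -/
noncomputable def meanSensed (p : Params) (lam c : ℝ) : ℝ :=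
  lam * ∫ b in (Metric.closedBall (0 : Plane) 0)ᶜ, p.sense c ‖b - 0‖

lemma sensedBeyond_eq {lam c : ℝ} (hlam : 0 < lam) (hc : 0 < c) (a : Plane) :
    sensedBeyond p (ENNReal.ofReal lam • volume) c a = ENNReal.ofReal (meanBeyond p lam c ‖a‖) := by
  rw [sensedBeyond, lintegral_smul_sense hlam hc, setIntegral_sense_eq, meanBeyond]

lemma lintegral_sense_eq {lam c : ℝ} (hlam : 0 < lam) (hc : 0 < c) :
    ∫⁻ b, ENNReal.ofReal (p.sense c ‖b‖) ∂(ENNReal.ofReal lam • (volume : Measure Plane)) =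
      ENNReal.ofReal (meanSensed p lam c) := by
  have h := lintegral_smul_sense (p := p) hlam hc (0 : Plane) Set.univ
  rw [Measure.restrict_univ] at h
  simp only [sub_zero] at h
  rw [h, meanSensed]
  congr 2
  simp only [sub_zero]
  refine setIntegral_congr_set (ae_eq_univ.2 ?_).symm
  simp

lemma meanBeyond_nonneg {lam c : ℝ} (hlam : 0 < lam) (r : ℝ) : 0 ≤ meanBeyond p lam c r :=
  mul_nonneg hlam.le (integral_nonneg fun _ => Params.sense_nonneg _ _)

/-- This keeps the denominator `m` in `(1 - e^{-m}) / m` away from zero. -/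
lemma meanSensed_pos {lam c : ℝ} (hlam : 0 < lam) (hc : 0 < c) : 0 < meanSensed p lam c := by
  refine mul_pos hlam ?_
  have h : Integrable fun b : Plane => p.sense c ‖b - 0‖ := integrable_sense_sub hc 0
  have h1 : ((Metric.closedBall (0 : Plane) 0)ᶜ : Set Plane) =ᵐ[volume] Set.univ :=
    ae_eq_univ.2 (by simp)
  rw [setIntegral_congr_set h1, setIntegral_univ,
    integral_pos_iff_support_of_nonneg (fun _ => Params.sense_nonneg _ _) h]
  have h2 : (Function.support fun b : Plane => p.sense c ‖b - 0‖) = Set.univ :=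
    Set.eq_univ_of_forall fun b => (Real.exp_pos _).ne'
  rw [h2]
  simp

/-- The domain of integration varies with `r`; it is absorbed into an indicator on `ℝ × Plane` so
that measurability of parameter integrals applies. -/
lemma measurable_meanBeyond (lam c : ℝ) : Measurable (meanBeyond p lam c) := by
  have h1 : Measurable (Function.uncurry fun (r : ℝ) (b : Plane) =>
      {w : ℝ × Plane | w.1 < ‖w.2‖}.indicator (fun w => p.sense c ‖w.2 - !₂[w.1, 0]‖) (r, b)) := by
    refine Measurable.indicator ?_ (measurableSet_lt (by fun_prop) (by fun_prop))
    exact ((p.continuous_sense c).comp (by fun_prop)).measurable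
  have h2 := h1.stronglyMeasurable.integral_prod_right (ν := (volume : Measure Plane))
  convert h2.measurable.const_mul lam using 1
  ext r
  rw [meanBeyond, ← integral_indicator measurableSet_closedBall.compl]
  congr 2 with b
  by_cases hb : r < ‖b‖ <;> simp [Set.indicator, hb]

lemma lintegral_expNeg_ofReal_mul {m : ℝ} (hm : 0 < m) :
    ∫⁻ t in Set.Icc (0 : ℝ) 1, expNeg (ENNReal.ofReal t * ENNReal.ofReal m) =
      ENNReal.ofReal ((1 - Real.exp (-m)) / m) := by
  have h1 : ∫⁻ t in Set.Icc (0 : ℝ) 1, expNeg (ENNReal.ofReal t * ENNReal.ofReal m) =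
      ∫⁻ t in Set.Icc (0 : ℝ) 1, ENNReal.ofReal (Real.exp (-m * t)) := by
    refine setLIntegral_congr_fun measurableSet_Icc fun t ht => ?_
    rw [← ENNReal.ofReal_mul ht.1, expNeg_ofReal (mul_nonneg ht.1 hm.le)]
    ring_nf
  have hint : IntegrableOn (fun t : ℝ => Real.exp (-m * t)) (Set.Icc 0 1) :=
    (by fun_prop : Continuous fun t : ℝ => Real.exp (-m * t)).integrableOn_Icc
  rw [h1, ← ofReal_integral_eq_lintegral_ofReal hint (ae_of_all _ fun t => (Real.exp_pos _).le),
    integral_Icc_eq_integral_Ioc, ← intervalIntegral.integral_of_le zero_le_one,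
    intervalIntegral.integral_comp_mul_left (fun s => Real.exp s) (neg_ne_zero.2 hm.ne'),
    integral_exp]
  congr 1
  simp only [mul_one, mul_zero, Real.exp_zero, smul_eq_mul]
  field_simp
  ring

lemma volume_ball_norm {lam : ℝ} (hlam : 0 < lam) (a : Plane) :
    (ENNReal.ofReal lam • (volume : Measure Plane)) (Metric.ball 0 ‖a‖) =
      ENNReal.ofReal (lam * Real.pi * ‖a‖ ^ 2) := by
  rw [Measure.smul_apply, EuclideanSpace.volume_ball_fin_two, smul_eq_mul,
    ← ENNReal.ofReal_pow (norm_nonneg a), ← ENNReal.ofReal_mul (by positivity),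
    ← ENNReal.ofReal_mul hlam.le]
  ring_nf

/-- A Gaussian integral: the law of the nearest point has total mass `1`. This is what uniqueness of
the nearest point requires. -/
lemma lintegral_expNeg_ball {lam : ℝ} (hlam : 0 < lam) :
    ∫⁻ a, expNeg ((ENNReal.ofReal lam • (volume : Measure Plane)) (Metric.ball 0 ‖a‖))
      ∂(ENNReal.ofReal lam • (volume : Measure Plane)) = 1 := by
  have hb : 0 < lam * Real.pi := mul_pos hlam Real.pi_pos
  have h1 : ∀ a : Plane, expNeg ((ENNReal.ofReal lam • (volume : Measure Plane))
      (Metric.ball 0 ‖a‖)) = ENNReal.ofReal (Real.exp (-(lam * Real.pi) * ‖a‖ ^ 2)) := fun a => by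
    rw [volume_ball_norm hlam, expNeg_ofReal (by positivity), neg_mul]
  have h2 := GaussianFourier.integral_rexp_neg_mul_sq_norm (V := Plane) hb
  have hint : Integrable fun a : Plane => Real.exp (-(lam * Real.pi) * ‖a‖ ^ 2) := by
    -- A non-integrable function would have Bochner integral `0`, against the positive Gaussian
    -- value.
    by_contra hcon
    rw [integral_undef hcon] at h2
    exact absurd h2.symm (Real.rpow_pos_of_pos (div_pos Real.pi_pos hb) _).ne'
  simp_rw [h1]
  rw [lintegral_smul_measure, ← ofReal_integral_eq_lintegral_ofReal hint
    (ae_of_all _ fun a => (Real.exp_pos _).le), h2, smul_eq_mul, ← ENNReal.ofReal_mul hlam.le]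
  rw [finrank_euclideanSpace_fin]
  norm_num
  field_simp

/-- Polar coordinates. -/
lemma setIntegral_Ioi_of_lintegral_ne_top {lam : ℝ} (hlam : 0 < lam) {h : ℝ → ℝ}
    (hm : Measurable h) (h0 : ∀ r, 0 ≤ h r)
    (hfin : ∫⁻ a : Plane, ENNReal.ofReal (h ‖a‖) ∂(ENNReal.ofReal lam • volume) ≠ ∞) :
    IntegrableOn (fun r => h r * (lam * 2 * Real.pi * r)) (Set.Ioi 0) ∧
    ∫⁻ a : Plane, ENNReal.ofReal (h ‖a‖) ∂(ENNReal.ofReal lam • volume) =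
      ENNReal.ofReal (∫ r in Set.Ioi (0 : ℝ), h r * (lam * 2 * Real.pi * r)) := by
  rw [lintegral_smul_measure, smul_eq_mul] at hfin ⊢
  have hfin' : ∫⁻ a : Plane, ENNReal.ofReal (h ‖a‖) ≠ ∞ := fun hcon => by
    rw [hcon, ENNReal.mul_top (by simpa using hlam)] at hfin
    exact hfin rfl
  have hint : Integrable fun a : Plane => h ‖a‖ :=
    ⟨(hm.comp measurable_norm).aestronglyMeasurable,
      (hasFiniteIntegral_iff_ofReal (ae_of_all _ fun a => h0 _)).2 hfin'.lt_top⟩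
  have hpol := integral_fun_norm_addHaar (volume : Measure Plane) h
  have hball : (volume : Measure Plane).real (Metric.ball 0 1) = Real.pi := by
    rw [Measure.real, EuclideanSpace.volume_ball_fin_two]
    simp [Real.pi_pos.le]
  constructor
  · have := (integrable_fun_norm_addHaar (volume : Measure Plane)).1 hint
    refine IntegrableOn.congr_fun (this.mul_const (lam * 2 * Real.pi)) (fun r _ => ?_)
      measurableSet_Ioi
    simp only [finrank_euclideanSpace_fin, smul_eq_mul]
    norm_num
    ring
  · rw [← ofReal_integral_eq_lintegral_ofReal hint (ae_of_all _ fun a => h0 _),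
      ← ENNReal.ofReal_mul hlam.le, hpol, hball]
    congr 1
    simp only [finrank_euclideanSpace_fin, smul_eq_mul, nsmul_eq_mul]
    have : ∀ r : ℝ, h r * (lam * 2 * Real.pi * r) = (lam * 2 * Real.pi) * (r ^ (2 - 1) * h r) :=
      fun r => by norm_num; ring
    simp_rw [this]
    rw [integral_const_mul]
    push_cast
    ring

/-! ### Access probabilities in the network -/

section Access

variable {Ω : Type*} [MeasurableSpace Ω] {P : Measure Ω} [IsProbabilityMeasure P]
  {x y : ℕ → Ω → Plane} {c d lx ly : ℝ}

instance sigmaFinite_ofReal_smul (lam : ℝ) :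
    SigmaFinite (ENNReal.ofReal lam • (volume : Measure Plane)) :=
  inferInstanceAs (SigmaFinite (lam.toNNReal • (volume : Measure Plane)))

/-- The access probability of a tagged transmitter at distance `r`, times the density of `r`. -/
noncomputable def accessDensity (p : Params) (lx ly c d r : ℝ) : ℝ :=
  (1 - Real.exp (-(meanBeyond p lx c r + meanSensed p ly d))) /
    (meanBeyond p lx c r + meanSensed p ly d) *
    (lx * 2 * Real.pi * r * Real.exp (-lx * Real.pi * r ^ 2))

theorem measure_nearest_not_blocked_eq (hlx : 0 < lx) (hly : 0 < ly)
    (hPx : IsPoissonProcess (counting x) (ENNReal.ofReal lx • volume) P)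
    (hPy : IsPoissonProcess (counting y) (ENNReal.ofReal ly • volume) P)
    (hx : ∀ i, Measurable (x i)) (hy : ∀ i, Measurable (y i))
    (hxy : IndepFun (fun ω i => x i ω) (fun ω k => y k ω) P)
    (hnear : ∀ᵐ ω ∂P, ∀ i, ‖x 0 ω‖ ≤ ‖x i ω‖)
    (hc : 0 < c) (hd : 0 < d) {M : Node ⊕ Node → Ω → ℝ}
    (hM : ∀ i, Measurable (M i)) (hind : iIndepFun M P)
    (htimer : ∀ v, HasLaw (M (Sum.inl v)) (volume[|Set.Icc (0 : ℝ) 1]) P)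
    (hfading : ∀ v, HasLaw (M (Sum.inr v)) (expMeasure p.mu) P)
    (hloc : IndepFun (fun ω => ((fun i => x i ω : ℕ → Plane), (fun k => y k ω : ℕ → Plane)))
      (fun ω i => M i ω) P) :
    IntegrableOn (accessDensity p lx ly c d) (Set.Ioi 0) ∧
    P {ω | (∀ j, j ≠ 0 → M (Sum.inl (Sum.inl j)) ω < M (Sum.inl (Sum.inl 0)) ω →
          M (Sum.inr (Sum.inl j)) ω / p.pathLoss ‖x j ω - x 0 ω‖ ≤ c) ∧
        ∀ m, M (Sum.inl (Sum.inr m)) ω < M (Sum.inl (Sum.inl 0)) ω →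
          M (Sum.inr (Sum.inr m)) ω / p.pathLoss ‖y m ω - x 0 ω‖ ≤ d} =
      ENNReal.ofReal (∫ r in Set.Ioi (0 : ℝ), accessDensity p lx ly c d r) := by
  set νx : Measure Plane := ENNReal.ofReal lx • volume
  have hνx : ∀ r : ℝ, νx (Metric.closedBall 0 r) ≠ ∞ := fun r =>
    ENNReal.mul_ne_top ENNReal.ofReal_ne_top measure_closedBall_lt_top.ne
  have hsph : ∀ r : ℝ, νx (Metric.sphere 0 r) = 0 := fun r => by
    simp [νx, Measure.addHaar_sphere]
  have hlt := hPx.ae_norm_lt hx hνx (lintegral_expNeg_ball hlx) hnear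
  set h : ℝ → ℝ := fun r => Real.exp (-(lx * Real.pi * r ^ 2)) *
    ((1 - Real.exp (-(meanBeyond p lx c r + meanSensed p ly d))) /
      (meanBeyond p lx c r + meanSensed p ly d)) with hh
  have hpos : ∀ r, 0 < meanBeyond p lx c r + meanSensed p ly d := fun r =>
    add_pos_of_nonneg_of_pos (meanBeyond_nonneg hlx r) (meanSensed_pos hly hd)
  have h0 : ∀ r, 0 ≤ h r := fun r => mul_nonneg (Real.exp_pos _).le
    (div_nonneg (sub_nonneg.2 (Real.exp_le_one_iff.2 (neg_nonpos.2 (hpos r).le))) (hpos r).le)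
  have hmA := measurable_meanBeyond (p := p) lx c
  have hhm : Measurable h := by fun_prop
  have key : P {ω | (∀ j, j ≠ 0 → M (Sum.inl (Sum.inl j)) ω < M (Sum.inl (Sum.inl 0)) ω →
          M (Sum.inr (Sum.inl j)) ω / p.pathLoss ‖x j ω - x 0 ω‖ ≤ c) ∧
        ∀ m, M (Sum.inl (Sum.inr m)) ω < M (Sum.inl (Sum.inl 0)) ω →
          M (Sum.inr (Sum.inr m)) ω / p.pathLoss ‖y m ω - x 0 ω‖ ≤ d} =
      ∫⁻ a, ENNReal.ofReal (h ‖a‖) ∂νx := by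
    rw [measure_nearest_not_blocked hPx hPy hx hy hxy hνx hsph (fun a => by simp) hlt hc hd hM hind
      htimer hfading hloc, lintegral_sense_eq hly hd]
    simp_rw [νx, volume_ball_norm hlx, sensedBeyond_eq hlx hc]
    simp_rw [← lintegral_const_mul' _ _ (expNeg_ne_top _), ← expNeg_add]
    -- For fixed `a` the two exponents merge into `t * (meanBeyond + meanSensed)`, and the integral
    -- over the timer is elementary.
    rw [lintegral_lintegral_swap]
    · refine lintegral_congr fun a => ?_
      have h1 : ∀ t : ℝ, expNeg (ENNReal.ofReal t * ENNReal.ofReal (meanSensed p ly d) +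
          (ENNReal.ofReal (lx * Real.pi * ‖a‖ ^ 2) +
            ENNReal.ofReal t * ENNReal.ofReal (meanBeyond p lx c ‖a‖))) =
          ENNReal.ofReal (Real.exp (-(lx * Real.pi * ‖a‖ ^ 2))) * expNeg (ENNReal.ofReal t *
            ENNReal.ofReal (meanBeyond p lx c ‖a‖ + meanSensed p ly d)) := fun t => by
        rw [← expNeg_ofReal (by positivity), ← expNeg_add,
          ENNReal.ofReal_add (meanBeyond_nonneg hlx _) (meanSensed_pos hly hd).le]
        congr 1
        ring
      simp_rw [h1]
      rw [lintegral_const_mul' _ _ ENNReal.ofReal_ne_top, lintegral_expNeg_ofReal_mul (hpos _),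
        ← ENNReal.ofReal_mul (Real.exp_pos _).le]
    · exact (by fun_prop : Measurable _).aemeasurable
  -- Integrability costs nothing: the integral equals a probability.
  have hfin : ∫⁻ a, ENNReal.ofReal (h ‖a‖) ∂νx ≠ ∞ := key ▸ measure_ne_top P _
  have hpol := setIntegral_Ioi_of_lintegral_ne_top hlx hhm h0 hfin
  have heq : (fun r => h r * (lx * 2 * Real.pi * r)) = accessDensity p lx ly c d := by
    ext r
    rw [accessDensity, hh]
    ring_nf
  rw [heq] at hpol
  rw [key]
  exact ⟨hpol.1, hpol.2.trans (by rw [← heq])⟩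

/-- The access probability for timers and fading variables that are only almost everywhere
measurable. -/
theorem integral_ite_nearest_not_blocked (hlx : 0 < lx) (hly : 0 < ly)
    (hPx : IsPoissonProcess (counting x) (ENNReal.ofReal lx • volume) P)
    (hPy : IsPoissonProcess (counting y) (ENNReal.ofReal ly • volume) P)
    (hx : ∀ i, Measurable (x i)) (hy : ∀ i, Measurable (y i))
    (hxy : IndepFun (fun ω i => x i ω) (fun ω k => y k ω) P)
    (hnear : ∀ᵐ ω ∂P, ∀ i, ‖x 0 ω‖ ≤ ‖x i ω‖)
    (hc : 0 < c) (hd : 0 < d) {M : Node ⊕ Node → Ω → ℝ} (hind : iIndepFun M P)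
    (htimer : ∀ v, HasLaw (M (Sum.inl v)) (volume[|Set.Icc (0 : ℝ) 1]) P)
    (hfading : ∀ v, HasLaw (M (Sum.inr v)) (expMeasure p.mu) P)
    (hloc : IndepFun (fun ω => ((fun i => x i ω : ℕ → Plane), (fun k => y k ω : ℕ → Plane)))
      (fun ω i => M i ω) P) {e : Ω → ℝ}
    (he : ∀ ω, e ω = {ω | (∀ j, j ≠ 0 →
          M (Sum.inl (Sum.inl j)) ω < M (Sum.inl (Sum.inl 0)) ω →
          M (Sum.inr (Sum.inl j)) ω / p.pathLoss ‖x j ω - x 0 ω‖ ≤ c) ∧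
        ∀ m, M (Sum.inl (Sum.inr m)) ω < M (Sum.inl (Sum.inl 0)) ω →
          M (Sum.inr (Sum.inr m)) ω / p.pathLoss ‖y m ω - x 0 ω‖ ≤ d}.indicator 1 ω) :
    Integrable e P ∧ IntegrableOn (accessDensity p lx ly c d) (Set.Ioi 0) ∧
      ∫ ω, e ω ∂P = ∫ r in Set.Ioi (0 : ℝ), accessDensity p lx ly c d r := by
  -- The laws give only almost everywhere measurability; since there are countably many marks,
  -- measurable versions agree with all of them simultaneously off a null set.
  have hMae : ∀ i, AEMeasurable (M i) P := by
    rintro (v | v)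
    exacts [(htimer v).aemeasurable, (hfading v).aemeasurable]
  set M' : Node ⊕ Node → Ω → ℝ := fun i => (hMae i).mk (M i)
  have hM' : ∀ i, Measurable (M' i) := fun i => (hMae i).measurable_mk
  have hMM : ∀ i, M i =ᵐ[P] M' i := fun i => (hMae i).ae_eq_mk
  have hall : ∀ᵐ ω ∂P, ∀ i, M i ω = M' i ω := ae_all_iff.2 hMM
  have hloc' := hloc.congr (f' := fun ω => ((fun i => x i ω : ℕ → Plane),
    (fun k => y k ω : ℕ → Plane))) (g' := fun ω i => M' i ω) (ae_of_all _ fun _ => rfl)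
    (hall.mono fun ω hω => funext hω)
  have main := measure_nearest_not_blocked_eq hlx hly hPx hPy hx hy hxy hnear hc hd hM'
    (hind.congr hMM) (fun v => (htimer v).congr (hMM _).symm)
    (fun v => (hfading v).congr (hMM _).symm) hloc'
  set S' := {ω | (∀ j, j ≠ 0 → M' (Sum.inl (Sum.inl j)) ω < M' (Sum.inl (Sum.inl 0)) ω →
          M' (Sum.inr (Sum.inl j)) ω / p.pathLoss ‖x j ω - x 0 ω‖ ≤ c) ∧
        ∀ m, M' (Sum.inl (Sum.inr m)) ω < M' (Sum.inl (Sum.inl 0)) ω →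
          M' (Sum.inr (Sum.inr m)) ω / p.pathLoss ‖y m ω - x 0 ω‖ ≤ d} with hS'
  have hpl := (p.continuous_pathLoss).measurable
  have hSm : MeasurableSet S' := by
    refine MeasurableSet.inter ?_ ?_
    · refine measurableSet_setOfPred.2 (Measurable.forall fun j => ?_)
      refine Measurable.imp measurable_const (Measurable.imp ?_ ?_)
      · exact measurableSet_setOfPred.1 (measurableSet_lt (hM' _) (hM' _))
      · exact measurableSet_setOfPred.1 (measurableSet_le ((hM' _).div
          (hpl.comp ((hx j).sub (hx 0)).norm)) measurable_const)
    · refine measurableSet_setOfPred.2 (Measurable.forall fun m => ?_)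
      refine Measurable.imp ?_ ?_
      · exact measurableSet_setOfPred.1 (measurableSet_lt (hM' _) (hM' _))
      · exact measurableSet_setOfPred.1 (measurableSet_le ((hM' _).div
          (hpl.comp ((hy m).sub (hx 0)).norm)) measurable_const)
  have hae : e =ᵐ[P] S'.indicator 1 := by
    filter_upwards [hall] with ω hω
    classical
    rw [he ω, Set.indicator_apply, Set.indicator_apply]
    refine if_congr ?_ rfl rfl
    simp only [hS', Set.mem_ofPred_eq, hω]
  have hint : Integrable (S'.indicator (1 : Ω → ℝ)) P :=
    (integrable_const (1 : ℝ)).indicator hSm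
  refine ⟨hint.congr hae.symm, main.1, ?_⟩
  rw [integral_congr_ae hae, integral_indicator_one hSm, Measure.real, main.2,
    ENNReal.toReal_ofReal]
  refine setIntegral_nonneg measurableSet_Ioi fun r hr => ?_
  have hpos : 0 < meanBeyond p lx c r + meanSensed p ly d :=
    add_pos_of_nonneg_of_pos (meanBeyond_nonneg hlx r) (meanSensed_pos hly hd)
  have hr' : (0 : ℝ) < r := hr
  exact mul_nonneg (div_nonneg (sub_nonneg.2 (Real.exp_le_one_iff.2 (neg_nonpos.2 hpos.le)))
    hpos.le) (by positivity)

end Access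

open Classical in
lemma tprod_clear {ι : Type*} (s g : ι → ℝ) (t c : ℝ) :
    ∏' i, clear (s i) t (g i) c = if ∀ i, s i < t → g i ≤ c then 1 else 0 := by
  simp_rw [clear_eq]
  convert (hasProd_ite fun i => s i < t → g i ≤ c).tprod_eq

end LBT

/-! ### The tagged access point and the tagged eNB -/

theorem mainTheorem5 (p : LBT.Params) {Ω : Type*} [MeasurableSpace Ω] (P : Measure Ω)
    [IsProbabilityMeasure P] (N : LBT.Network p 0 1 P) :
    (Integrable (N.eW 0) P ∧
      IntegrableOn (fun r₀ : ℝ => (1 - Real.exp (-p.nW2 r₀ - p.nL)) / (p.nW2 r₀ + p.nL) * p.fW r₀)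
        (Set.Ioi 0) ∧
      ∫ ω, N.eW 0 ω ∂P =
        ∫ r₀ in Set.Ioi (0 : ℝ),
          (1 - Real.exp (-p.nW2 r₀ - p.nL)) / (p.nW2 r₀ + p.nL) * p.fW r₀) ∧
    (Integrable (N.eL 0) P ∧
      IntegrableOn (fun r₀ : ℝ => (1 - Real.exp (-p.nW3 p.gamL - p.nL1 r₀ p.gamL)) /
        (p.nW3 p.gamL + p.nL1 r₀ p.gamL) * p.fL r₀) (Set.Ioi 0) ∧
      ∫ ω, N.eL 0 ω ∂P =
        ∫ r₀ in Set.Ioi (0 : ℝ),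
          (1 - Real.exp (-p.nW3 p.gamL - p.nL1 r₀ p.gamL)) /
            (p.nW3 p.gamL + p.nL1 r₀ p.gamL) * p.fL r₀) := by
  have htimer : ∀ v, HasLaw (N.timer v) (volume[|Set.Icc (0 : ℝ) 1]) P := by
    rintro (i | k)
    exacts [N.law_timer_ap i, N.law_timer_enb k]
  have hW : (fun r₀ : ℝ => (1 - Real.exp (-p.nW2 r₀ - p.nL)) / (p.nW2 r₀ + p.nL) * p.fW r₀) =
      LBT.accessDensity p p.lamW p.lamL (p.gamCS / p.powW) (p.gamED / p.powL) := by
    ext r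
    have h1 : p.nW2 r = LBT.meanBeyond p p.lamW (p.gamCS / p.powW) r := rfl
    have h2 : p.nL = LBT.meanSensed p p.lamL (p.gamED / p.powL) := rfl
    rw [LBT.accessDensity, h1, h2, neg_add, ← sub_eq_add_neg]
    rfl
  have hL : (fun r₀ : ℝ => (1 - Real.exp (-p.nW3 p.gamL - p.nL1 r₀ p.gamL)) /
        (p.nW3 p.gamL + p.nL1 r₀ p.gamL) * p.fL r₀) =
      LBT.accessDensity p p.lamL p.lamW (p.gamL / p.powL) (p.gamL / p.powW) := by
    ext r
    have h1 : p.nL1 r p.gamL = LBT.meanBeyond p p.lamL (p.gamL / p.powL) r := rfl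
    have h2 : p.nW3 p.gamL = LBT.meanSensed p p.lamW (p.gamL / p.powW) := rfl
    rw [LBT.accessDensity, h1, h2, neg_add_rev, ← sub_eq_add_neg, add_comm (LBT.meanBeyond p _ _ _)]
    rfl
  constructor
  -- Only channels into the tagged access point matter; they and the timers form a subfamily of the
  -- marks via an injective reindexing.
  · set M : LBT.Node ⊕ LBT.Node → Ω → ℝ := Sum.elim N.timer fun v => N.fading v (Sum.inl 0) with hM
    have hind : iIndepFun M P := by
      have h1 : Function.Injective (Sum.elim (fun v => Sum.inl v) fun v => Sum.inr (v, Sum.inl 0) :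
          LBT.Node ⊕ LBT.Node → LBT.Node ⊕ LBT.Node × LBT.Node) := by
        exact Sum.inl_injective.sumElim (Sum.inr_injective.comp (Prod.mk_left_injective _))
          fun _ _ => Sum.inl_ne_inr
      convert N.indep_marks.precomp h1 using 1
      ext (v | v) ω <;> rfl
    have hloc := N.indep_locations_marks.comp measurable_id
      (ψ := fun z (i : LBT.Node ⊕ LBT.Node) => Sum.elim z.1 (fun v => z.2 v (Sum.inl 0)) i) (by
        refine measurable_pi_lambda _ ?_
        rintro (v | v) <;> simp only [Sum.elim_inl, Sum.elim_inr] <;> fun_prop)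
    have main := LBT.integral_ite_nearest_not_blocked (p := p) (e := N.eW 0) p.lamW_pos p.lamL_pos
      N.poisson_ap N.poisson_enb N.measurable_ap N.measurable_enb N.indep_locations N.nearest_ap
      (div_pos p.gamCS_pos p.powW_pos) (div_pos p.gamED_pos p.powL_pos) hind htimer
      (fun v => N.law_fading v (Sum.inl 0)) (by
        convert hloc using 1
        · rfl
        · funext ω i
          rcases i with v | v <;> rfl) (fun ω => by
        classical
        rw [LBT.Network.eW, LBT.tprod_clear, LBT.tprod_clear, ite_zero_mul_ite_zero, mul_one,
          Set.indicator_apply]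
        exact if_congr (and_congr Subtype.forall Iff.rfl) rfl rfl)
    rw [← hW] at main
    exact main
  -- The two networks exchange roles: `Sum.swap` relabels the eNBs as the left summand, which holds
  -- the tagged transmitter in the general result.
  · set M : LBT.Node ⊕ LBT.Node → Ω → ℝ := Sum.elim (fun v => N.timer v.swap)
      fun v => N.fading v.swap (Sum.inr 0) with hM
    have hind : iIndepFun M P := by
      have h1 : Function.Injective (Sum.elim (fun v => Sum.inl v.swap)
          fun v => Sum.inr (v.swap, Sum.inr 0) :
            LBT.Node ⊕ LBT.Node → LBT.Node ⊕ LBT.Node × LBT.Node) := by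
        exact (Sum.inl_injective.comp Sum.swap_leftInverse.injective).sumElim
          (Sum.inr_injective.comp ((Prod.mk_left_injective _).comp
            Sum.swap_leftInverse.injective)) fun _ _ => Sum.inl_ne_inr
      convert N.indep_marks.precomp h1 using 1
      ext (v | v) ω <;> rfl
    have hloc := N.indep_locations_marks.comp measurable_swap
      (ψ := fun z (i : LBT.Node ⊕ LBT.Node) => Sum.elim (fun v : LBT.Node => z.1 v.swap)
        (fun v : LBT.Node => z.2 v.swap (Sum.inr 0)) i) (by
        refine measurable_pi_lambda _ ?_
        rintro (v | v) <;> simp only [Sum.elim_inl, Sum.elim_inr] <;> fun_prop)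
    have main := LBT.integral_ite_nearest_not_blocked (p := p) (e := N.eL 0) p.lamL_pos p.lamW_pos
      N.poisson_enb N.poisson_ap N.measurable_enb N.measurable_ap N.indep_locations.symm
      N.nearest_enb (div_pos p.gamL_pos p.powL_pos) (div_pos p.gamL_pos p.powW_pos) hind
      (fun v => htimer v.swap) (fun v => N.law_fading v.swap (Sum.inr 0)) (by
        convert hloc using 1
        · rfl
        · funext ω i
          rcases i with v | v <;> rfl) (fun ω => by
        classical
        simp only [LBT.Network.eL, norm_sub_rev (N.enb 0 ω) (N.ap _ ω)]
        rw [LBT.tprod_clear, LBT.tprod_clear, ite_zero_mul_ite_zero, mul_one, Set.indicator_apply]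
        exact if_congr (and_comm.trans (and_congr Subtype.forall Iff.rfl)) rfl rfl)
    rw [← hL] at main
    exact main
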